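/- Let $F$ be a field of characteristic $2$, let $V$ be an $F$-vector space of finite dimension $m=2n\ge 2$, and let $f:V\times V\to F$ be a non-degenerate alternating bilinear form. Let $\mathfrak{gl}(V)=\operatorname{End}(V)$ with the commutator bracket, let $$L(f)=\{x\in\mathfrak{gl}(V): f(xv,w)=-f(v,xw)\ \text{for all } v,w\in V\},$$ let $L(f)^{(1)}=[L(f),L(f)]$ and $L(f)^{(2)}=[L(f)^{(1)},L(f)^{(1)}]$, let $\mathfrak s=Z(\mathfrak{gl}(V))$ be the set of scalar operators, and let $\mathfrak{sl}(V)$ be the set of operators of trace $0$. These are $L(f)$-submodules of $\mathfrak{gl}(V)$ (whenever $\mathfrak s$ or $\mathfrak{sl}(V)$ is placed in a chain below, the inclusions are part of the claim). Inside the $L(f)$-module $V\otimes V$ let $S^2(V)$ be the span of all $v\otimes v$ and $v\otimes w+w\otimes v$, and let $\Lambda^2(V)$ be the span of all $v\wedge w=v\otimes w-w\otimes v$. Call a basis of $V$ symplectic if the Gram matrix of $f$ relative to it is $\begin{pmatrix}0&I_n\\-I_n&0\end{pmatrix}$. A square matrix $B$ is alternating if $B_{ij}=-B_{ji}$ and $B_{ii}=0$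 for all $i,j$. Symplectic bases exist, and the following holds. (1) Suppose $4\mid m$. Then the $L(f)$-module $\mathfrak{gl}(V)$ has exactly $m+6$ composition factors. For any symplectic basis, let $x$ be the operator with matrix $\begin{pmatrix}I_n&0\\0&0\end{pmatrix}$. Then $x\in\mathfrak{sl}(V)$, $[x,L(f)]\subseteq L(f)$, $x\notin L(f)$, $U=L(f)\oplus\langle x\rangle$ is an $L(f)$-submodule, and inserting any strictly increasing chain of $m-1$ subspaces strictly between $L(f)^{(1)}$ and $L(f)$ (such chains exist) in $$0\subset\mathfrak s\subset L(f)^{(2)}\subset L(f)^{(1)}\subset L(f)\subset U\subset\mathfrak{sl}(V)\subset\mathfrak{gl}(V)$$ gives a composition series. All its factors are trivial modules except $L(f)^{(2)}/\mathfrak s$ and $\mathfrak{sl}(V)/U$, which are isomorphic non-trivial $L(f)$-modules of dimension $\binom m2-2$. Moreover, $L(f)^{(2)}/\mathfrak s$ is a simple Lie algebra if and only if $m>4$. (2) Suppose $m\ne 2$ and $4\nmid m$. Then the $L(f)$-module $\mathfrak{gl}(V)$ has exactly $m+4$ composition factors. Inserting any strictly increasing chain of $m-1$ subspaces strictly between $L(f)^{(1)}$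 and $L(f)$ (such chains exist) in $$0\subset L(f)^{(2)}\subset L(f)^{(1)}\subset L(f)\subset\mathfrak{sl}(V)\subset\mathfrak{gl}(V)$$ gives a composition series. All its factors are trivial modules except $L(f)^{(2)}$ and $\mathfrak{sl}(V)/L(f)$, which are isomorphic non-trivial $L(f)$-modules. Moreover, $L(f)^{(2)}$ is a simple Lie algebra of dimension $\binom m2-1$. (3) $L(f)\cong S^2(V)$ as $L(f)$-modules, and relative to any symplectic basis $L(f)$ consists of all operators with matrix $$\begin{pmatrix}A&B\\C&A'\end{pmatrix},\qquad A,B,C\in\mathfrak{gl}(n),\ B,C\ \text{symmetric},\qquad(*)$$ where $A'$ is the transpose of $A$. (4) $L(f)^{(1)}\cong\Lambda^2(V)$ as $L(f)$-modules, and relative to any symplectic basis $L(f)^{(1)}$ consists of all operators with matrix $(*)$ such that $B,C$ are alternating. (5) There is an epimorphism of $L(f)$-modules $\Lambda^2(V)\to F$ (with $F$ trivial) such that $v\wedge w\mapsto f(v,w)$, and $L(f)^{(2)}$ is isomorphic to its kernel as an $L(f)$-module. Relative to any symplectic basis $L(f)^{(2)}$ consists of all operators with matrix $(*)$ such that $B,C$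 are alternating and $\operatorname{tr}(A)=0$. (6) $L(f)/L(f)^{(2)}$ is isomorphic, as a Lie algebra, to the Heisenberg algebra $\mathfrak h(n)$ of dimension $2n+1$, i.e. $F^n\oplus F^n\oplus F$ with bracket $[(a,b,c),(a',b',c')]=\bigl(0,0,\sum_i (a_ib_i'-a_i'b_i)\bigr)$. -/

import Mathlib

open Module TensorProduct

-- The commutator bracket of an associative ring, in particular of `gl(V) = End(V)`.
attribute [local instance 100] LieRing.ofAssociativeRing

/-! ### Modules over a Lie algebra: factors and composition series -/

/-- The module `Q / P`, for submodules `P ≤ Q` of a module over a Lie algebra (in general it is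
`Q / (P ∩ Q)`). -/
abbrev lieFactor {F L M : Type*} [CommRing F] [LieRing L] [LieAlgebra F L] [AddCommGroup M]
    [Module F M] [LieRingModule L M] [LieModule F L M] (P Q : LieSubmodule F L M) : Type _ :=
  ↥Q ⧸ LieSubmodule.comap Q.incl P

/-- `0 = N 0 ≤ N 1 ≤ ⋯ ≤ N k = M` is a composition series with `k` factors: every factor
`N (i + 1) / N i` is irreducible (in particular non-zero). The values `N i` for `i > k` play
no role. -/
def IsLieCompositionSeries {F L M : Type*} [CommRing F] [LieRing L] [LieAlgebra F L]
    [AddCommGroup M] [Module F M] [LieRingModule L M] [LieModule F L M]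
    (k : ℕ) (N : ℕ → LieSubmodule F L M) : Prop :=
  N 0 = ⊥ ∧ N k = ⊤ ∧
    ∀ i < k, N i ≤ N (i + 1) ∧ LieModule.IsIrreducible F L (lieFactor (N i) (N (i + 1)))

/-- The module `M` has exactly `k` composition factors: it has a composition series with `k`
factors, and all its composition series have `k` factors. -/
def HasLieCompositionLength (F L M : Type*) [CommRing F] [LieRing L] [LieAlgebra F L]
    [AddCommGroup M] [Module F M] [LieRingModule L M] [LieModule F L M] (k : ℕ) : Prop :=
  (∃ N : ℕ → LieSubmodule F L M, IsLieCompositionSeries k N) ∧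
    ∀ (k' : ℕ) (N : ℕ → LieSubmodule F L M), IsLieCompositionSeries k' N → k' = k

/-- `P = W 0 < W 1 < ⋯ < W k = Q` is a strictly increasing chain of subspaces, i.e. `k - 1`
subspaces are inserted between `P` and `Q`. -/
def IsSubspaceChain {F M : Type*} [Ring F] [AddCommGroup M] [Module F M]
    (P Q : Submodule F M) (k : ℕ) (W : ℕ → Submodule F M) : Prop :=
  W 0 = P ∧ W k = Q ∧ ∀ j < k, W j < W (j + 1)

/-! ### Symmetric and exterior squares inside `V ⊗ V` -/

section Squares

variable (F L V : Type*) [CommRing F] [LieRing L] [LieAlgebra F L] [AddCommGroup V]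
  [Module F V] [LieRingModule L V] [LieModule F L V]

/-- The symmetric square `S²(V)`: the subspace of `V ⊗ V` spanned by all `v ⊗ v` and all
`v ⊗ w + w ⊗ v`. -/
def symSquare : LieSubmodule F L (V ⊗[F] V) where
  __ := Submodule.span F
    ({t | ∃ v : V, t = v ⊗ₜ[F] v} ∪ {t | ∃ v w : V, t = v ⊗ₜ[F] w + w ⊗ₜ[F] v})
  lie_mem := by
    intro x t ht
    change t ∈ Submodule.span F _ at ht
    change ⁅x, t⁆ ∈ Submodule.span F _
    induction ht using Submodule.span_induction with
    | mem t ht =>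
      rcases ht with ⟨v, rfl⟩ | ⟨v, w, rfl⟩
      · apply Submodule.subset_span
        exact Or.inr ⟨⁅x, v⁆, v, by simp⟩
      · have h : ⁅x, v ⊗ₜ[F] w + w ⊗ₜ[F] v⁆ =
            (⁅x, v⁆ ⊗ₜ[F] w + w ⊗ₜ[F] ⁅x, v⁆) + (v ⊗ₜ[F] ⁅x, w⁆ + ⁅x, w⁆ ⊗ₜ[F] v) := by
          simp only [lie_add, TensorProduct.LieModule.lie_tmul_right]; abel
        rw [h]
        exact add_mem (Submodule.subset_span (Or.inr ⟨_, _, rfl⟩))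
          (Submodule.subset_span (Or.inr ⟨_, _, rfl⟩))
    | zero => simp
    | add a b _ _ ha hb => rw [lie_add]; exact add_mem ha hb
    | smul c a _ ha => rw [lie_smul]; exact Submodule.smul_mem _ c ha

/-- The exterior square `Λ²(V)`: the subspace of `V ⊗ V` spanned by all
`v ∧ w = v ⊗ w - w ⊗ v`. -/
def extSquare : LieSubmodule F L (V ⊗[F] V) where
  __ := Submodule.span F {t | ∃ v w : V, t = v ⊗ₜ[F] w - w ⊗ₜ[F] v}
  lie_mem := by
    intro x t ht
    change t ∈ Submodule.span F _ at ht
    change ⁅x, t⁆ ∈ Submodule.span F _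
    induction ht using Submodule.span_induction with
    | mem t ht =>
      obtain ⟨v, w, rfl⟩ := ht
      have h : ⁅x, v ⊗ₜ[F] w - w ⊗ₜ[F] v⁆ =
          (⁅x, v⁆ ⊗ₜ[F] w - w ⊗ₜ[F] ⁅x, v⁆) + (v ⊗ₜ[F] ⁅x, w⁆ - ⁅x, w⁆ ⊗ₜ[F] v) := by
        simp only [lie_sub, TensorProduct.LieModule.lie_tmul_right]; abel
      rw [h]
      exact add_mem (Submodule.subset_span ⟨_, _, rfl⟩) (Submodule.subset_span ⟨_, _, rfl⟩)
    | zero => simp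
    | add a b _ _ ha hb => rw [lie_add]; exact add_mem ha hb
    | smul c a _ ha => rw [lie_smul]; exact Submodule.smul_mem _ c ha

variable {V}

/-- The element `v ∧ w = v ⊗ w - w ⊗ v` of `Λ²(V)`. -/
def wedge (v w : V) : ↥(extSquare F L V) :=
  ⟨v ⊗ₜ[F] w - w ⊗ₜ[F] v, Submodule.subset_span ⟨v, w, rfl⟩⟩

end Squares

/-! ### `gl(V)` as a module over `L(f)` and its submodules -/

section Submodules

variable {F V : Type*} [Field F] [AddCommGroup V] [Module F V]

/-- The Lie subalgebra `L(f)` of `gl(V)` of all `x` with `f (x v) w = - f v (x w)`. -/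
abbrev lieOf (f : LinearMap.BilinForm F V) : LieSubalgebra F (End F V) :=
  skewAdjointLieSubalgebra f

theorem mem_lieOf (f : LinearMap.BilinForm F V) (x : End F V) :
    x ∈ lieOf f ↔ ∀ v w, f (x v) w = - f v (x w) := by
  change x ∈ LinearMap.skewAdjointSubmodule f ↔ _
  rw [LinearMap.mem_skewAdjointSubmodule]
  simp [LinearMap.IsSkewAdjoint, LinearMap.IsAdjointPair]

/-- `sl(V)`, the ideal of `gl(V)` of the endomorphisms of trace zero. -/
noncomputable def slIdeal (F V : Type*) [Field F] [AddCommGroup V] [Module F V] : LieIdeal F (End F V) where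
  __ := LinearMap.ker (LinearMap.trace F V)
  lie_mem := by
    intro x y _
    change LinearMap.trace F V ⁅x, y⁆ = 0
    rw [LieRing.of_associative_ring_bracket, map_sub, LinearMap.trace_mul_comm, sub_self]

variable (f : LinearMap.BilinForm F V)

/-- `𝔰 = Z(gl(V))`, the scalar operators, as an `L(f)`-submodule of `gl(V)`. -/
def scalarSub : LieSubmodule F (lieOf f) (End F V) :=
  LieSubmodule.restr (LieAlgebra.center F (End F V)) (lieOf f)

/-- `sl(V)` as an `L(f)`-submodule of `gl(V)`. -/
noncomputable def slSub : LieSubmodule F (lieOf f) (End F V) := LieSubmodule.restr (slIdeal F V) (lieOf f)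

/-- `L(f)` as an `L(f)`-submodule of `gl(V)`. -/
def lieSub : LieSubmodule F (lieOf f) (End F V) := (lieOf f).toLieSubmodule

/-- The term `L(f)^(k)` of the derived series of `L(f)`, an ideal of `L(f)`. -/
abbrev derivedIdeal (k : ℕ) : LieIdeal F (lieOf f) := LieAlgebra.derivedSeries F (lieOf f) k

/-- The term `L(f)^(k)` of the derived series of `L(f)` as an `L(f)`-submodule of `gl(V)`. -/
def derivedSub (k : ℕ) : LieSubmodule F (lieOf f) (End F V) :=
  LieSubmodule.map (lieOf f).incl' (derivedIdeal f k)

/-- The scalar operators in `L(f)^(2)`, as an ideal of the Lie algebra `L(f)^(2)`. -/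
def scalarIdeal : LieIdeal F ↥(derivedIdeal f 2) :=
  LieIdeal.comap ((lieOf f).incl.comp (derivedIdeal f 2).incl) (LieAlgebra.center F (End F V))

end Submodules

/-! ### Matrices -/

/-- A square matrix is alternating if `A i j = - A j i` and `A i i = 0`. -/
def IsAlternatingMatrix {F ι : Type*} [Ring F] (A : Matrix ι ι F) : Prop :=
  (∀ i j, A i j = - A j i) ∧ ∀ i, A i i = 0

/-- The basis `b` of `V` is symplectic for `f`: the Gram matrix `f (b i) (b j)` of `f` is
`[[0, 1], [-1, 0]]`. -/
def IsSymplecticBasis {F V : Type*} [Field F] [AddCommGroup V] [Module F V] {n : ℕ}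
    (f : LinearMap.BilinForm F V) (b : Basis (Fin n ⊕ Fin n) F V) : Prop :=
  Matrix.of (fun i j => f (b i) (b j)) = Matrix.fromBlocks 0 1 (-1) 0

/-- The operator with matrix `[[1, 0], [0, 0]]` relative to the basis `b`. -/
noncomputable def halfIdentity {F V : Type*} [Field F] [AddCommGroup V] [Module F V] {n : ℕ}
    (b : Basis (Fin n ⊕ Fin n) F V) : End F V :=
  Matrix.toLin b b (Matrix.fromBlocks 1 0 0 0)

/-! ### The Heisenberg algebra -/

/-- The Heisenberg algebra `𝔥(n)` of dimension `2 n + 1`: the space `F^n ⊕ F^n ⊕ F` with bracket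
`[(a, b, c), (a', b', c')] = (0, 0, ∑ i, (a i * b' i - a' i * b i))`. -/
def HeisenbergAlgebra (F : Type*) (n : ℕ) : Type _ := (Fin n → F) × (Fin n → F) × F

namespace HeisenbergAlgebra

variable {F : Type*} [Field F] {n : ℕ}

instance : AddCommGroup (HeisenbergAlgebra F n) :=
  inferInstanceAs (AddCommGroup ((Fin n → F) × (Fin n → F) × F))

instance : Module F (HeisenbergAlgebra F n) :=
  inferInstanceAs (Module F ((Fin n → F) × (Fin n → F) × F))

instance : Bracket (HeisenbergAlgebra F n) (HeisenbergAlgebra F n) where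
  bracket x y := (0, 0, ∑ i, (x.1 i * y.2.1 i - y.1 i * x.2.1 i))

theorem bracket_def (x y : HeisenbergAlgebra F n) :
    ⁅x, y⁆ = ((0, 0, ∑ i, (x.1 i * y.2.1 i - y.1 i * x.2.1 i)) :
      (Fin n → F) × (Fin n → F) × F) := rfl

instance : LieRing (HeisenbergAlgebra F n) where
  add_lie x y z := by
    refine Prod.ext (add_zero (0 : Fin n → F)).symm
      (Prod.ext (add_zero (0 : Fin n → F)).symm ?_)
    change ∑ i, ((x.1 i + y.1 i) * z.2.1 i - z.1 i * (x.2.1 i + y.2.1 i)) =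
      ∑ i, (x.1 i * z.2.1 i - z.1 i * x.2.1 i) + ∑ i, (y.1 i * z.2.1 i - z.1 i * y.2.1 i)
    rw [← Finset.sum_add_distrib]
    exact Finset.sum_congr rfl fun i _ => by ring
  lie_add x y z := by
    refine Prod.ext (add_zero (0 : Fin n → F)).symm
      (Prod.ext (add_zero (0 : Fin n → F)).symm ?_)
    change ∑ i, (x.1 i * (y.2.1 i + z.2.1 i) - (y.1 i + z.1 i) * x.2.1 i) =
      ∑ i, (x.1 i * y.2.1 i - y.1 i * x.2.1 i) + ∑ i, (x.1 i * z.2.1 i - z.1 i * x.2.1 i)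
    rw [← Finset.sum_add_distrib]
    exact Finset.sum_congr rfl fun i _ => by ring
  lie_self x := by
    refine Prod.ext rfl (Prod.ext rfl ?_)
    change ∑ i, (x.1 i * x.2.1 i - x.1 i * x.2.1 i) = 0
    simp
  leibniz_lie x y z := by
    have h : ∀ u v w : HeisenbergAlgebra F n, ⁅u, ⁅v, w⁆⁆ = 0 := fun u v w => by
      refine Prod.ext rfl (Prod.ext rfl ?_)
      change ∑ i, (u.1 i * (0 : F) - (0 : F) * u.2.1 i) = 0
      simp
    have h' : ∀ u v w : HeisenbergAlgebra F n, ⁅⁅u, v⁆, w⁆ = 0 := fun u v w => by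
      refine Prod.ext rfl (Prod.ext rfl ?_)
      change ∑ i, ((0 : F) * w.2.1 i - w.1 i * (0 : F)) = 0
      simp
    rw [h, h', h, add_zero]

instance : LieAlgebra F (HeisenbergAlgebra F n) where
  lie_smul c x y := by
    refine Prod.ext (smul_zero c).symm (Prod.ext (smul_zero c).symm ?_)
    change ∑ i, (x.1 i * (c * y.2.1 i) - c * y.1 i * x.2.1 i) =
      c * ∑ i, (x.1 i * y.2.1 i - y.1 i * x.2.1 i)
    rw [Finset.mul_sum]
    exact Finset.sum_congr rfl fun i _ => by ring

end HeisenbergAlgebra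

/-!
In characteristic two `f` is symmetric, so `x ∈ L(f)` says that the form `f (x v) w` is symmetric,
and everything is read off from this form. The non-degenerate form identifies `V ⊗ V` with `gl(V)`,
`v ⊗ w` becoming the operator `u ↦ f w u • v` (`rankOneOp`, `tensorOp`). Under this isomorphism
of `L(f)`-modules `S²(V)` is `L(f)`, and `Λ²(V)` is the submodule `altSub` of the operators whose
form is alternating, spanned by the images `wedgeOp f v w` of the `v ∧ w`
(`mem_span_wedgeOp`). Brackets with `wedgeOp`s are given by `lie_wedgeOp`, and they yield
`L(f)^(1) = altSub` (`derivedSub_one`) and `L(f)^(2) = perpSub`, the span of the `wedgeOp f v w` with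
`f v w = 0` (`derivedSub_two`). In terms of a symplectic basis, `perpSub` is cut out of `altSub` by
`halfTrace`, the trace of the upper left block of the matrix, which sends `wedgeOp f v w` to `f v w`
(`mem_perpSpan_iff`). The diagonal of the Gram matrix of `f (x v) w`, which vanishes exactly on
`altSub`, together with `halfTrace` defines the homomorphism onto the Heisenberg algebra
(`halfTrace_lie`, `toHeisenberg`).

The homomorphism `x ↦ x - x*` of `L(f)`-modules (`altPart`) has kernel `L(f)` and image `altSub`,
and the trace of `x` is the `halfTrace` of its image. It therefore maps `sl(V)` onto
`L(f)^(2)`, which pairs the two non-trivial factors, and it maps the operator with matrix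
`[[1, 0], [0, 0]]` to the identity. As the identity has `halfTrace` equal to `n`, the scalars lie in
`L(f)^(2)` exactly when `n` is even; this separates the two cases.

The only factors whose irreducibility is not a matter of dimension are `L(f)^(2)` modulo
its scalars and its counterpart in `sl(V)`. If `x` is alternating and not scalar, there are orthogonal
`a` and `b` with `f b (x a) ≠ 0`, and bracketing `x` with `u ↦ f a u • a` and `u ↦ f b u • b` gives a
multiple of `wedgeOp f b a`. From one such element one reaches `wedgeOp f v w` for
all orthogonal `v` and `w` by replacing one vector at a time (`perpSpan_le_of_replace`,
`perpSub_le_of_mem`). If `dim V > 4`, brackets with elements of `L(f)^(2)` suffice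
(`perpSpan_le_of_mem`), whence the simplicity of the Lie algebra. If `dim V = 4`, the Lie algebra
`L(f)^(2)` is commutative modulo scalars (`lie_mem_scalarSub_of_mem_perpSpan`).
-/

/-! ### Factors of a chain of Lie submodules -/

section Factors

variable {F L M M' : Type*} [CommRing F] [LieRing L] [LieAlgebra F L] [AddCommGroup M]
  [Module F M] [LieRingModule L M] [LieModule F L M] [AddCommGroup M'] [Module F M']
  [LieRingModule L M'] [LieModule F L M']

theorem lieFactor_isTrivial_iff {P Q : LieSubmodule F L M} :
    LieModule.IsTrivial L (lieFactor P Q) ↔ ∀ x : L, ∀ q ∈ Q, ⁅x, q⁆ ∈ P := by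
  constructor
  · intro h x q hq
    have h1 := h.trivial x (LieSubmodule.Quotient.mk (⟨q, hq⟩ : Q))
    exact (LieSubmodule.Quotient.mk_eq_zero' (N := LieSubmodule.comap Q.incl P)
      (m := ⁅x, (⟨q, hq⟩ : Q)⁆)).1 h1
  · intro h
    refine ⟨fun x t => ?_⟩
    obtain ⟨q, rfl⟩ := LieSubmodule.Quotient.surjective_mk' _ t
    exact LieSubmodule.Quotient.mk_eq_zero'.2 (h x q q.2)

theorem lieFactor_isIrreducible_iff {P Q : LieSubmodule F L M} (hPQ : P ≤ Q) :
    LieModule.IsIrreducible F L (lieFactor P Q) ↔ P ⋖ Q := by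
  constructor
  · intro h
    have hmem (R : LieSubmodule F L M) (q : Q) :
        LieSubmodule.Quotient.mk' (LieSubmodule.comap Q.incl P) q ∈
          LieSubmodule.map (LieSubmodule.Quotient.mk' (LieSubmodule.comap Q.incl P))
            (LieSubmodule.comap Q.incl R) ↔ ∃ r ∈ R, r - q ∈ P := by
      rw [LieSubmodule.mem_map]
      constructor
      · rintro ⟨r, hr, he⟩
        refine ⟨r, hr, ?_⟩
        rw [← sub_eq_zero, ← map_sub, LieSubmodule.Quotient.mk_eq_zero] at he
        exact he
      · rintro ⟨r, hr, he⟩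
        have hrQ : r ∈ Q := by simpa using Q.add_mem (hPQ he) q.2
        refine ⟨⟨r, hrQ⟩, hr, ?_⟩
        rw [← sub_eq_zero, ← map_sub, LieSubmodule.Quotient.mk_eq_zero]
        exact he
    refine ⟨lt_of_le_of_ne hPQ ?_, ?_⟩
    · rintro rfl
      obtain ⟨t, ht⟩ := exists_ne (⊥ : LieSubmodule F L (lieFactor P P))
      refine ht (le_bot_iff.1 fun s _ => ?_)
      obtain ⟨q, rfl⟩ := LieSubmodule.Quotient.surjective_mk' _ s
      rw [LieSubmodule.mem_bot, LieSubmodule.Quotient.mk_eq_zero]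
      exact q.2
    · intro R hPR hRQ
      rcases eq_bot_or_eq_top (LieSubmodule.map
        (LieSubmodule.Quotient.mk' (LieSubmodule.comap Q.incl P))
            (LieSubmodule.comap Q.incl R)) with h0 | h1
      · refine hPR.not_ge fun r hr => ?_
        have h2 := (hmem R ⟨r, hRQ.le hr⟩).2 ⟨r, hr, by simp⟩
        rw [h0, LieSubmodule.mem_bot, LieSubmodule.Quotient.mk_eq_zero] at h2
        exact h2
      · refine hRQ.not_ge fun q hq => ?_
        obtain ⟨r, hr, hp⟩ := (hmem R ⟨q, hq⟩).1 (by rw [h1]; trivial)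
        simpa using R.sub_mem hr (hPR.le hp)
  · intro h
    obtain ⟨q, hq, hqP⟩ := SetLike.exists_of_lt h.lt
    have : Nontrivial (lieFactor P Q) :=
      ⟨LieSubmodule.Quotient.mk' _ ⟨q, hq⟩, 0, fun h0 =>
        hqP ((LieSubmodule.Quotient.mk_eq_zero (LieSubmodule.comap Q.incl P)).1 h0)⟩
    refine LieModule.IsIrreducible.mk fun N hN => ?_
    let R : LieSubmodule F L M := LieSubmodule.map Q.incl
      (LieSubmodule.comap (LieSubmodule.Quotient.mk' (LieSubmodule.comap Q.incl P)) N)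
    have hR : ∀ q : Q, (q : M) ∈ R ↔
        LieSubmodule.Quotient.mk' (LieSubmodule.comap Q.incl P) q ∈ N := by
      intro q
      rw [LieSubmodule.mem_map]
      constructor
      · rintro ⟨r, hr, he⟩
        rwa [← Subtype.ext he]
      · intro hr
        exact ⟨q, hr, rfl⟩
    have hPR : P ≤ R := fun p hp => (hR ⟨p, hPQ hp⟩).2 (by
      rw [(LieSubmodule.Quotient.mk_eq_zero (LieSubmodule.comap Q.incl P)
        (m := ⟨p, hPQ hp⟩)).2 hp]
      exact N.zero_mem)
    have hRQ : R ≤ Q := by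
      rintro _ ⟨r, -, rfl⟩
      exact r.2
    clear_value R
    rcases h.eq_or_eq hPR hRQ with rfl | rfl
    · refine absurd (le_bot_iff.1 fun s hs => ?_) hN
      obtain ⟨q, rfl⟩ := LieSubmodule.Quotient.surjective_mk' _ s
      rw [LieSubmodule.mem_bot, LieSubmodule.Quotient.mk_eq_zero]
      exact (hR q).2 hs
    · refine top_le_iff.1 fun s _ => ?_
      obtain ⟨q, rfl⟩ := LieSubmodule.Quotient.surjective_mk' _ s
      exact (hR q).1 q.2

theorem isLieCompositionSeries_iff {k : ℕ} {N : ℕ → LieSubmodule F L M} :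
    IsLieCompositionSeries k N ↔ N 0 = ⊥ ∧ N k = ⊤ ∧ ∀ i < k, N i ⋖ N (i + 1) := by
  refine and_congr_right fun _ => and_congr_right fun _ => forall₂_congr fun i _ => ?_
  exact ⟨fun h => (lieFactor_isIrreducible_iff h.1).1 h.2,
    fun h => ⟨h.le, (lieFactor_isIrreducible_iff h.le).2 h⟩⟩

/-- The Jordan–Hölder theorem: one composition series determines the number of composition
factors. It is an instance of Jordan–Hölder for the modular lattice of Lie submodules. -/
theorem IsLieCompositionSeries.hasLieCompositionLength {k : ℕ} {N : ℕ → LieSubmodule F L M}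
    (hN : IsLieCompositionSeries k N) : HasLieCompositionLength F L M k := by
  refine ⟨⟨N, hN⟩, fun k' N' hN' => ?_⟩
  rw [isLieCompositionSeries_iff] at hN hN'
  let s : CompositionSeries (LieSubmodule F L M) :=
    ⟨k, fun i => N i, fun i => hN.2.2 i i.2⟩
  let s' : CompositionSeries (LieSubmodule F L M) :=
    ⟨k', fun i => N' i, fun i => hN'.2.2 i i.2⟩
  have h := CompositionSeries.jordan_holder s' s
    (hN'.1.trans hN.1.symm) (hN'.2.1.trans hN.2.1.symm)
  exact h.length_eq

/-- The first isomorphism theorem for Lie modules. -/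
noncomputable def LieModuleHom.quotEquivOfSurjective (N : LieSubmodule F L M)
    (g : M →ₗ⁅F,L⁆ M') (hN : ∀ x, g x = 0 ↔ x ∈ N) (hg : Function.Surjective g) :
    (M ⧸ N) ≃ₗ⁅F,L⁆ M' :=
  let e : (M ⧸ N.toSubmodule) ≃ₗ[F] M' :=
    (Submodule.quotEquivOfEq N.toSubmodule (LinearMap.ker (g : M →ₗ[F] M'))
      (by ext x; exact (hN x).symm)).trans
      ((g : M →ₗ[F] M').quotKerEquivOfSurjective hg)
  { e with
    map_lie' := by
      intro x t
      obtain ⟨q, rfl⟩ := LieSubmodule.Quotient.surjective_mk' _ t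
      exact g.map_lie x q }

/-- The first isomorphism theorem for Lie algebras. -/
noncomputable def LieHom.quotEquivOfSurjective {L' : Type*} [LieRing L'] [LieAlgebra F L']
    (I : LieIdeal F L) (g : L →ₗ⁅F⁆ L') (hI : ∀ x, g x = 0 ↔ x ∈ I)
    (hg : Function.Surjective g) : (L ⧸ I) ≃ₗ⁅F⁆ L' :=
  let e : (L ⧸ I.toSubmodule) ≃ₗ[F] L' :=
    (Submodule.quotEquivOfEq I.toSubmodule (LinearMap.ker (g : L →ₗ[F] L'))
      (by ext x; exact (hI x).symm)).trans
      ((g : L →ₗ[F] L').quotKerEquivOfSurjective hg)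
  { e with
    map_lie' := by
      intro s t
      obtain ⟨p, rfl⟩ := LieSubmodule.Quotient.surjective_mk' _ s
      obtain ⟨q, rfl⟩ := LieSubmodule.Quotient.surjective_mk' _ t
      exact g.map_lie p q }

/-- A bijective homomorphism of Lie modules is an equivalence. -/
noncomputable def LieModuleEquiv.ofBijectiveHom (g : M →ₗ⁅F,L⁆ M') (hg : Function.Bijective g) :
    M ≃ₗ⁅F,L⁆ M' :=
  { LinearEquiv.ofBijective (g : M →ₗ[F] M') hg with map_lie' := fun {x m} => g.map_lie x m }

end Factors

theorem finrank_lieFactor {F L M : Type*} [Field F] [LieRing L] [LieAlgebra F L] [AddCommGroup M]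
    [Module F M] [LieRingModule L M] [LieModule F L M] [FiniteDimensional F M]
    {P Q : LieSubmodule F L M} (h : P ≤ Q) :
    finrank F (lieFactor P Q) + finrank F P = finrank F Q := by
  have h1 := Submodule.finrank_quotient_add_finrank (LieSubmodule.comap Q.incl P).toSubmodule
  have h2 : finrank F (LieSubmodule.comap Q.incl P).toSubmodule = finrank F P :=
    (Submodule.comapSubtypeEquivOfLe h).finrank_eq
  rw [← h2]
  exact h1

/-! ### Vectors orthogonal to given ones -/

section Orthogonal

variable {F V : Type*} [Field F] [AddCommGroup V] [Module F V]

theorem LinearMap.BilinForm.IsAlt.apply_comm [CharP F 2] {f : LinearMap.BilinForm F V}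
    (halt : f.IsAlt) (v w : V) : f v w = f w v := by
  have h := halt.neg_eq v w
  rwa [CharTwo.neg_eq] at h

theorem neg_eq_self_of_charTwo (F : Type*) {V : Type*} [Field F] [CharP F 2] [AddCommGroup V]
    [Module F V] (v : V) : -v = v := by
  rw [← neg_one_smul F v, CharTwo.neg_eq, one_smul]

theorem sub_eq_add_of_charTwo (F : Type*) {V : Type*} [Field F] [CharP F 2] [AddCommGroup V]
    [Module F V] (v w : V) : v - w = v + w := by
  rw [sub_eq_add_neg, neg_eq_self_of_charTwo F]

/-- A subspace contained in neither of two subspaces is not contained in their union. -/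
theorem Submodule.exists_mem_notMem_notMem {U W₁ W₂ : Submodule F V} (h₁ : ¬ U ≤ W₁)
    (h₂ : ¬ U ≤ W₂) : ∃ z ∈ U, z ∉ W₁ ∧ z ∉ W₂ := by
  obtain ⟨x, hx, hx₁⟩ := SetLike.not_le_iff_exists.1 h₁
  obtain ⟨y, hy, hy₂⟩ := SetLike.not_le_iff_exists.1 h₂
  by_cases hx₂ : x ∈ W₂
  · by_cases hy₁ : y ∈ W₁
    · exact ⟨x + y, U.add_mem hx hy, fun h => hx₁ ((W₁.add_mem_iff_left hy₁).1 h),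
        fun h => hy₂ ((W₂.add_mem_iff_right hx₂).1 h)⟩
    · exact ⟨y, hy, hy₁, hy₂⟩
  · exact ⟨x, hx, hx₁, hx₂⟩

theorem finrank_span_singleton_le_one (v : V) : finrank F (Submodule.span F {v}) ≤ 1 := by
  simpa using finrank_span_le_card (R := F) ({v} : Set V)

theorem finrank_span_pair_le_two (v w : V) : finrank F (Submodule.span F {v, w}) ≤ 2 := by
  classical
  refine (finrank_span_le_card (R := F) ({v, w} : Set V)).trans ?_
  simpa using Finset.card_le_two (a := v) (b := w)

/-- If `u` and `v` are independent and `a` is not in their span, then `u` is not in the span of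
`v` and `a`. -/
theorem notMem_span_pair_of_notMem_span_pair {a u v : V} (hu : u ∉ Submodule.span F {v})
    (ha : a ∉ Submodule.span F {u, v}) : u ∉ Submodule.span F {v, a} := by
  intro h
  obtain ⟨p, q, rfl⟩ := Submodule.mem_span_pair.1 h
  have hq : q ≠ 0 := by
    rintro rfl
    exact hu (Submodule.mem_span_singleton.2 ⟨p, by simp⟩)
  refine ha (Submodule.mem_span_pair.2 ⟨q⁻¹, -(q⁻¹ * p), ?_⟩)
  rw [smul_add, smul_smul, smul_smul, inv_mul_cancel₀ hq, one_smul, neg_smul]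
  abel

theorem notMem_span_singleton_comm {u v : V} (hv : v ≠ 0) (hu : u ∉ Submodule.span F {v}) :
    v ∉ Submodule.span F {u} := by
  intro h
  obtain ⟨c, rfl⟩ := Submodule.mem_span_singleton.1 h
  have hc : c ≠ 0 := by
    rintro rfl
    exact hv (zero_smul F u)
  exact hu (Submodule.mem_span_singleton.2 ⟨c⁻¹, by rw [smul_smul, inv_mul_cancel₀ hc, one_smul]⟩)

variable [FiniteDimensional F V] {f : LinearMap.BilinForm F V}

theorem LinearMap.BilinForm.Nondegenerate.exists_forall_apply_eq (hf : f.Nondegenerate)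
    (g : V →ₗ[F] F) : ∃ r, ∀ v, f r v = g v :=
  ⟨(f.toDual hf).symm g, fun v => LinearMap.BilinForm.apply_toDual_symm_apply (hB := hf) g v⟩

theorem LinearMap.BilinForm.Nondegenerate.exists_apply_eq_one (hf : f.Nondegenerate)
    {W : Submodule F V} {v : V} (hv : v ∉ W) : ∃ r, (∀ w ∈ W, f r w = 0) ∧ f r v = 1 := by
  obtain ⟨g, hgv, hg⟩ := Submodule.exists_dual_map_eq_bot_of_notMem hv inferInstance
  obtain ⟨r, hr⟩ := hf.exists_forall_apply_eq ((g v)⁻¹ • g)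
  refine ⟨r, fun w hw => ?_, ?_⟩
  · have h : g w ∈ W.map g := Submodule.mem_map_of_mem hw
    rw [hg, Submodule.mem_bot] at h
    rw [hr, LinearMap.smul_apply, h, smul_zero]
  · rw [hr, LinearMap.smul_apply, smul_eq_mul, inv_mul_cancel₀ hgv]

theorem LinearMap.BilinForm.Nondegenerate.exists_apply_ne_zero (hf : f.Nondegenerate)
    {b a w : V} (ha : a ∉ Submodule.span F {b}) (hw : w ∉ Submodule.span F {b}) :
    ∃ c, f c b = 0 ∧ f c a ≠ 0 ∧ f c w ≠ 0 := by
  obtain ⟨r, hr, hra⟩ := hf.exists_apply_eq_one ha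
  obtain ⟨s, hs, hsw⟩ := hf.exists_apply_eq_one hw
  have hb : b ∈ Submodule.span F {b} := Submodule.mem_span_singleton_self b
  obtain ⟨z, hz, hz₁, hz₂⟩ := Submodule.exists_mem_notMem_notMem
    (U := LinearMap.ker (f.flip b)) (W₁ := LinearMap.ker (f.flip a))
    (W₂ := LinearMap.ker (f.flip w))
    (fun h => by simpa [hra] using h (show r ∈ _ by simpa using hr b hb))
    (fun h => by simpa [hsw] using h (show s ∈ _ by simpa using hs b hb))
  exact ⟨z, by simpa using hz, by simpa using hz₁, by simpa using hz₂⟩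

/-- Fewer than `dim V - dim W` orthogonality conditions have a solution outside `W`. -/
theorem LinearMap.BilinForm.exists_orthogonal_notMem (f : LinearMap.BilinForm F V) {k : ℕ}
    (s : Fin k → V) {W₁ W₂ : Submodule F V} (h₁ : k + finrank F W₁ < finrank F V)
    (h₂ : k + finrank F W₂ < finrank F V) :
    ∃ z, (∀ i, f z (s i) = 0) ∧ z ∉ W₁ ∧ z ∉ W₂ := by
  let T : V →ₗ[F] (Fin k → F) := LinearMap.pi fun i => f.flip (s i)
  have hT := T.finrank_range_add_finrank_ker
  have hr : finrank F (LinearMap.range T) ≤ k := by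
    simpa using Submodule.finrank_le (LinearMap.range T)
  have hle {W : Submodule F V} (h : k + finrank F W < finrank F V) : ¬ LinearMap.ker T ≤ W := by
    intro hW
    have := Submodule.finrank_mono hW
    omega
  obtain ⟨z, hz, hz₁, hz₂⟩ := Submodule.exists_mem_notMem_notMem (hle h₁) (hle h₂)
  exact ⟨z, fun i => congrFun (LinearMap.mem_ker.1 hz) i, hz₁, hz₂⟩

end Orthogonal

/-! ### Symplectic bases -/

section SymplecticBasis

variable {F V : Type*} [Field F] [AddCommGroup V] [Module F V]

/-- Any number of hyperbolic pairs, as long as there is room for them: if `k` pairs do not span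
`V`, project a vector outside their span and a vector pairing to `1` with it onto the orthogonal
complement of the pairs. -/
theorem exists_hyperbolic_pairs [FiniteDimensional F V] {f : LinearMap.BilinForm F V}
    (hf : f.Nondegenerate) (halt : f.IsAlt) (k : ℕ) (hk : 2 * k ≤ finrank F V) :
    ∃ e g : ℕ → V, ∀ i < k, ∀ j < k,
      f (e i) (e j) = 0 ∧ f (g i) (g j) = 0 ∧ f (e i) (g j) = if i = j then 1 else 0 := by
  induction k with
  | zero => exact ⟨0, 0, fun i hi => absurd hi (Nat.not_lt_zero i)⟩
  | succ k ih =>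
    obtain ⟨e, g, h⟩ := ih (by omega)
    let p (v : V) : V := v - ∑ i ∈ Finset.range k, (f v (g i) • e i - f v (e i) • g i)
    have hpe (v : V) (j : ℕ) (hj : j < k) : f (p v) (e j) = 0 := by
      simp only [p, map_sub, map_sum, map_smul, LinearMap.sub_apply, LinearMap.sum_apply,
        LinearMap.smul_apply, smul_eq_mul]
      rw [Finset.sum_eq_single_of_mem j (Finset.mem_range.2 hj), (h j hj j hj).1,
        ← halt.neg_eq (e j) (g j), (h j hj j hj).2.2]
      · simp
      · intro i hi hij
        have hi := Finset.mem_range.1 hi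
        rw [(h i hi j hj).1, ← halt.neg_eq (e j) (g i), (h j hj i hi).2.2, if_neg (Ne.symm hij)]
        simp
    have hpg (v : V) (j : ℕ) (hj : j < k) : f (p v) (g j) = 0 := by
      simp only [p, map_sub, map_sum, map_smul, LinearMap.sub_apply, LinearMap.sum_apply,
        LinearMap.smul_apply, smul_eq_mul]
      rw [Finset.sum_eq_single_of_mem j (Finset.mem_range.2 hj), (h j hj j hj).2.1,
        (h j hj j hj).2.2]
      · simp
      · intro i hi hij
        have hi := Finset.mem_range.1 hi
        rw [(h i hi j hj).2.1, (h i hi j hj).2.2, if_neg hij]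
        simp
    classical
    obtain ⟨v, hv⟩ : ∃ v, p v ≠ 0 := by
      by_contra hcon
      push Not at hcon
      let s : Finset V := (Finset.range k).image e ∪ (Finset.range k).image g
      have hs : Submodule.span F (s : Set V) = ⊤ := by
        refine top_le_iff.1 fun v _ => ?_
        rw [sub_eq_zero.1 (hcon v)]
        refine Submodule.sum_mem _ fun i hi => Submodule.sub_mem _ ?_ ?_
        · refine Submodule.smul_mem _ _ (Submodule.subset_span ?_)
          exact Finset.mem_coe.2 (Finset.mem_union_left _ (Finset.mem_image_of_mem e hi))
        · refine Submodule.smul_mem _ _ (Submodule.subset_span ?_)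
          exact Finset.mem_coe.2 (Finset.mem_union_right _ (Finset.mem_image_of_mem g hi))
      have h1 := finrank_span_finset_le_card (R := F) s
      have h2 := Finset.card_union_le ((Finset.range k).image e) ((Finset.range k).image g)
      have h3 := Finset.card_image_le (s := Finset.range k) (f := e)
      have h4 := Finset.card_image_le (s := Finset.range k) (f := g)
      rw [Set.finrank, hs, finrank_top] at h1
      rw [Finset.card_range] at h3 h4
      have h5 : s.card ≤ _ := h2
      omega
    obtain ⟨r, -, hr⟩ := hf.exists_apply_eq_one (W := ⊥) hv
    have hrv : f (p v) (p (-r)) = 1 := by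
      conv_lhs => rw [show p (-r) = -r - ∑ i ∈ Finset.range k,
        (f (-r) (g i) • e i - f (-r) (e i) • g i) from rfl]
      rw [map_sub, map_sum, Finset.sum_eq_zero, sub_zero, map_neg, halt.neg_eq, hr]
      intro i hi
      have hi := Finset.mem_range.1 hi
      rw [map_sub, map_smul, map_smul, hpe v i hi, hpg v i hi, smul_zero, smul_zero, sub_zero]
    have hswap {x y : V} (h0 : f x y = 0) : f y x = 0 := by rw [← halt.neg_eq x y, h0, neg_zero]
    refine ⟨Function.update e k (p v), Function.update g k (p (-r)), fun i hi j hj => ?_⟩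
    rcases Nat.lt_succ_iff_lt_or_eq.1 hi with hi | rfl <;>
      rcases Nat.lt_succ_iff_lt_or_eq.1 hj with hj | rfl
    · rw [Function.update_of_ne hi.ne, Function.update_of_ne hi.ne,
        Function.update_of_ne hj.ne, Function.update_of_ne hj.ne]
      exact h i hi j hj
    · rw [Function.update_of_ne hi.ne, Function.update_of_ne hi.ne, Function.update_self,
        Function.update_self, if_neg hi.ne]
      exact ⟨hswap (hpe _ _ hi), hswap (hpg _ _ hi), hswap (hpe _ _ hi)⟩
    · rw [Function.update_of_ne hj.ne, Function.update_of_ne hj.ne, Function.update_self,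
        Function.update_self, if_neg hj.ne']
      exact ⟨hpe _ _ hj, hpg _ _ hj, hpg _ _ hj⟩
    · rw [Function.update_self, Function.update_self, if_pos rfl]
      exact ⟨halt _, halt _, hrv⟩

theorem exists_isSymplecticBasis [FiniteDimensional F V] {f : LinearMap.BilinForm F V}
    (hf : f.Nondegenerate) (halt : f.IsAlt) {n : ℕ} (hn : finrank F V = 2 * n) :
    ∃ b : Basis (Fin n ⊕ Fin n) F V, IsSymplecticBasis f b := by
  obtain ⟨e, g, h⟩ := exists_hyperbolic_pairs hf halt n hn.ge
  have hee (i j : Fin n) : f (e i) (e j) = 0 := (h i i.2 j j.2).1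
  have hgg (i j : Fin n) : f (g i) (g j) = 0 := (h i i.2 j j.2).2.1
  have heg (i j : Fin n) : f (e i) (g j) = if i = j then 1 else 0 := by
    simp only [(h i i.2 j j.2).2.2, Fin.ext_iff]
  have hge (i j : Fin n) : f (g i) (e j) = if i = j then -1 else 0 := by
    rw [← halt.neg_eq, heg]
    by_cases hij : i = j
    · simp [hij]
    · simp [hij, Ne.symm hij]
  let v : Fin n ⊕ Fin n → V := Sum.elim (fun i => e i) (fun i => g i)
  have hv : LinearIndependent F v := by
    rw [Fintype.linearIndependent_iff]
    intro c hc
    have h1 (w : V) : f (∑ i, c i • v i) w = 0 := by rw [hc]; simp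
    rintro (i | i)
    · simpa [v, Fintype.sum_sum_type, heg, hgg] using h1 (g i)
    · simpa [v, Fintype.sum_sum_type, hee, hge] using h1 (e i)
  refine ⟨basisOfLinearIndependentOfCardEqFinrank' v hv (by simp [hn]; omega), ?_⟩
  rw [IsSymplecticBasis]
  ext i j
  rcases i with i | i <;> rcases j with j | j <;>
    simp [v, hee, hgg, heg, hge, Matrix.one_apply, Matrix.neg_apply] 
  split_ifs <;> simp

variable {f : LinearMap.BilinForm F V} {n : ℕ} {b : Basis (Fin n ⊕ Fin n) F V}

theorem IsSymplecticBasis.apply [CharP F 2] (hb : IsSymplecticBasis f b) (i j : Fin n ⊕ Fin n) :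
    f (b i) (b j) = if j = i.swap then 1 else 0 := by
  have h := congrFun (congrFun hb i) j
  rw [Matrix.of_apply] at h
  rw [h]
  rcases i with i | i <;> rcases j with j | j <;>
    simp [Matrix.one_apply, CharTwo.neg_eq, eq_comm]

theorem IsSymplecticBasis.repr_apply [CharP F 2] (hb : IsSymplecticBasis f b) (v : V)
    (i : Fin n ⊕ Fin n) : b.repr v i = f v (b i.swap) := by
  conv_rhs => rw [← b.sum_repr v]
  simp only [map_sum, map_smul, LinearMap.sum_apply, LinearMap.smul_apply, smul_eq_mul,
    hb.apply]
  rw [Finset.sum_eq_single i (fun j _ hji => ?_) (by simp), if_pos rfl, mul_one]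
  rw [if_neg fun h => hji (Sum.swap_leftInverse.injective h).symm, mul_zero]

theorem IsSymplecticBasis.ext_op [CharP F 2] (hb : IsSymplecticBasis f b) {x y : End F V}
    (h : ∀ i j, f (x (b i)) (b j) = f (y (b i)) (b j)) : x = y :=
  b.ext fun i => b.ext_elem fun j => by rw [hb.repr_apply, hb.repr_apply, h]

end SymplecticBasis

/-! ### Operators of rank one and alternating operators -/

section Operators

variable {F V : Type*} [Field F] [AddCommGroup V] [Module F V]

/-- The operator `u ↦ f w u • v`, as a bilinear map in `v` and `w`: the image of `v ⊗ w` under the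
isomorphism `V ⊗ V ≅ gl(V)` defined by a non-degenerate form. -/
def rankOneOp (f : LinearMap.BilinForm F V) : V →ₗ[F] V →ₗ[F] End F V :=
  (LinearMap.smulRightₗ ∘ₗ f).flip

/-- The operator `u ↦ f w u • v - f v u • w`, as a bilinear map in `v` and `w`: the image of
`v ∧ w` under the isomorphism `V ⊗ V ≅ gl(V)` defined by a non-degenerate form. -/
def wedgeOp (f : LinearMap.BilinForm F V) : V →ₗ[F] V →ₗ[F] End F V :=
  rankOneOp f - (rankOneOp f).flip

variable (f : LinearMap.BilinForm F V)

@[simp]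
theorem rankOneOp_apply (v w u : V) : rankOneOp f v w u = f w u • v := rfl

theorem wedgeOp_eq (v w : V) : wedgeOp f v w = rankOneOp f v w - rankOneOp f w v := rfl

theorem wedgeOp_apply (v w u : V) : wedgeOp f v w u = f w u • v - f v u • w := rfl

@[simp]
theorem wedgeOp_self (v : V) : wedgeOp f v v = 0 := sub_self _

theorem wedgeOp_swap (v w : V) : wedgeOp f v w = -wedgeOp f w v := (neg_sub _ _).symm

variable {f}

theorem wedgeOp_eq_zero_of_mem_span {v w : V} (h : w ∈ Submodule.span F {v}) :
    wedgeOp f w v = 0 := by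
  obtain ⟨c, rfl⟩ := Submodule.mem_span_singleton.1 h
  rw [map_smul, LinearMap.smul_apply, wedgeOp_self, smul_zero]

theorem lie_rankOneOp {x : End F V} (hx : x ∈ lieOf f) (v w : V) :
    ⁅x, rankOneOp f v w⁆ = rankOneOp f (x v) w + rankOneOp f v (x w) := by
  rw [mem_lieOf] at hx
  ext u
  simp [LieRing.of_associative_ring_bracket, hx, sub_eq_add_neg]

theorem lie_wedgeOp {x : End F V} (hx : x ∈ lieOf f) (v w : V) :
    ⁅x, wedgeOp f v w⁆ = wedgeOp f (x v) w + wedgeOp f v (x w) := by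
  rw [wedgeOp_eq, lie_sub, lie_rankOneOp hx, lie_rankOneOp hx, wedgeOp_eq, wedgeOp_eq]
  abel

theorem mem_lieSub {x : End F V} : x ∈ lieSub f ↔ x ∈ lieOf f := Iff.rfl

variable [CharP F 2]

theorem rankOneOp_self_mem_lieOf (halt : f.IsAlt) (v : V) : rankOneOp f v v ∈ lieOf f := by
  rw [mem_lieOf]
  intro u w
  rw [rankOneOp_apply, rankOneOp_apply, map_smul, map_smul, LinearMap.smul_apply, smul_eq_mul,
    smul_eq_mul, CharTwo.neg_eq, halt.apply_comm u v, mul_comm]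

theorem mem_lieOf_of_forall_apply_self (halt : f.IsAlt) {x : End F V}
    (hx : ∀ u, f (x u) u = 0) : x ∈ lieOf f := by
  rw [mem_lieOf]
  intro v w
  have h := hx (v + w)
  rw [map_add, map_add, map_add, LinearMap.add_apply, LinearMap.add_apply, hx, hx, zero_add,
    add_zero] at h
  rw [CharTwo.neg_eq, halt.apply_comm v, ← CharTwo.add_eq_zero]
  rw [add_comm]; exact h

theorem lie_apply_self (halt : f.IsAlt) {x y : End F V} (hx : x ∈ lieOf f) (hy : y ∈ lieOf f)
    (u : V) : f (⁅x, y⁆ u) u = 0 := by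
  rw [mem_lieOf] at hx hy
  rw [LieRing.of_associative_ring_bracket, LinearMap.sub_apply, End.mul_apply, End.mul_apply,
    map_sub, LinearMap.sub_apply, hx, hy, neg_neg, halt.apply_comm u, sub_self]

/-- The `L(f)`-submodule of `gl(V)` of the operators `x` such that the form `f (x v) w` is
alternating. -/
def altSub (halt : f.IsAlt) : LieSubmodule F (lieOf f) (End F V) where
  carrier := {x | ∀ u, f (x u) u = 0}
  add_mem' := by
    intro x y hx hy u
    rw [LinearMap.add_apply, map_add, LinearMap.add_apply, hx, hy, add_zero]
  zero_mem' := by simp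
  smul_mem' := by
    intro c x hx u
    rw [LinearMap.smul_apply, map_smul, LinearMap.smul_apply, hx, smul_zero]
  lie_mem := by
    rintro ⟨x, hx⟩ y hy u
    exact lie_apply_self halt hx (mem_lieOf_of_forall_apply_self halt hy) u

theorem altSub_le_lieSub (halt : f.IsAlt) : altSub halt ≤ lieSub f :=
  fun _ hx => mem_lieOf_of_forall_apply_self halt hx

theorem lie_mem_altSub (halt : f.IsAlt) {x y : End F V} (hx : x ∈ lieOf f) (hy : y ∈ lieOf f) :
    ⁅x, y⁆ ∈ altSub halt :=
  lie_apply_self halt hx hy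

theorem wedgeOp_mem_altSub (halt : f.IsAlt) (v w : V) : wedgeOp f v w ∈ altSub halt := by
  intro u
  rw [wedgeOp_apply, map_sub, map_smul, map_smul, LinearMap.sub_apply, LinearMap.smul_apply,
    LinearMap.smul_apply, smul_eq_mul, smul_eq_mul, mul_comm, sub_self]

variable {n : ℕ} {b : Basis (Fin n ⊕ Fin n) F V}

/-- An operator `x` for which `f (x v) w` is alternating is determined by the entries of the Gram
matrix of this form above the diagonal, hence is a combination of the `wedgeOp`s of the basis
vectors. -/
theorem mem_span_wedgeOp (hb : IsSymplecticBasis f b) (halt : f.IsAlt) {x : End F V}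
    (hx : x ∈ altSub halt) :
    x ∈ Submodule.span F {y | ∃ v w, y = wedgeOp f v w} := by
  have hx' := mem_lieOf_of_forall_apply_self halt hx
  rw [mem_lieOf] at hx'
  let e := Fintype.equivFin (Fin n ⊕ Fin n)
  have h : x = ∑ i, ∑ j, (if e i < e j then f (x (b i)) (b j) else 0) •
      wedgeOp f (b i.swap) (b j.swap) := by
    refine hb.ext_op fun k l => ?_
    have hterm (i j : Fin n ⊕ Fin n) : f (wedgeOp f (b i.swap) (b j.swap) (b k)) (b l) =
        (if j = k then if i = l then 1 else 0 else 0) -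
          if i = k then if j = l then 1 else 0 else 0 := by
      rw [wedgeOp_apply, map_sub, map_smul, map_smul, LinearMap.sub_apply, LinearMap.smul_apply,
        LinearMap.smul_apply, hb.apply, hb.apply, hb.apply, hb.apply]
      simp only [Sum.swap_swap, smul_eq_mul, mul_ite, mul_one, mul_zero, @eq_comm _ k,
        @eq_comm _ l]
      split_ifs <;> rfl
    simp only [LinearMap.sum_apply, LinearMap.smul_apply, map_sum, map_smul, smul_eq_mul, hterm,
      mul_sub, Finset.sum_sub_distrib, mul_ite, mul_one, mul_zero, Finset.sum_ite_eq',
      Finset.mem_univ, if_true]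
    rw [Finset.sum_comm]
    simp only [Finset.sum_ite_eq', Finset.mem_univ, if_true]
    have hlk : f (x (b l)) (b k) = f (x (b k)) (b l) := by
      rw [hx', CharTwo.neg_eq, halt.apply_comm]
    rcases lt_trichotomy (e k) (e l) with h | h | h
    · rw [if_neg h.not_gt, if_pos h, zero_sub, CharTwo.neg_eq]
    · rw [e.injective h]
      simp [hx (b l)]
    · rw [if_pos h, if_neg h.not_gt, sub_zero, hlk]
  rw [h]
  exact Submodule.sum_mem _ fun i _ => Submodule.sum_mem _ fun j _ =>
    Submodule.smul_mem _ _ (Submodule.subset_span ⟨_, _, rfl⟩)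

theorem mem_lieOf_iff_of_basis (b : Basis (Fin n ⊕ Fin n) F V) (halt : f.IsAlt) {x : End F V} :
    x ∈ lieOf f ↔ ∀ i j, f (x (b i)) (b j) = f (x (b j)) (b i) := by
  rw [mem_lieOf]
  constructor
  · intro h i j
    rw [h, CharTwo.neg_eq, halt.apply_comm]
  · intro h v w
    have h1 : f ∘ₗ x = (f ∘ₗ x).flip :=
      LinearMap.ext_basis b b fun i j => h i j
    have h2 := LinearMap.congr_fun (LinearMap.congr_fun h1 v) w
    rw [CharTwo.neg_eq, halt.apply_comm v]
    exact h2

/-- In characteristic two, `u ↦ f (x u) u` is additive for `x ∈ L(f)`. -/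
theorem mem_altSub_iff_of_basis (b : Basis (Fin n ⊕ Fin n) F V) (halt : f.IsAlt) {x : End F V} :
    x ∈ altSub halt ↔ x ∈ lieOf f ∧ ∀ i, f (x (b i)) (b i) = 0 := by
  refine ⟨fun h => ⟨mem_lieOf_of_forall_apply_self halt h, fun i => h (b i)⟩, fun ⟨h, hb⟩ u => ?_⟩
  rw [mem_lieOf] at h
  induction b.mem_span u using Submodule.span_induction with
  | mem u hu =>
    obtain ⟨i, rfl⟩ := hu
    exact hb i
  | zero => simp
  | add v w _ _ hv hw =>
    rw [map_add, map_add, map_add, LinearMap.add_apply, LinearMap.add_apply, hv, hw, zero_add,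
      add_zero, h v w, CharTwo.neg_eq, halt.apply_comm v, CharTwo.add_self_eq_zero]
  | smul c v _ hv => simp [hv]

theorem exists_sub_sum_rankOneOp_mem_altSub (hb : IsSymplecticBasis f b) (halt : f.IsAlt)
    {x : End F V} (hx : x ∈ lieOf f) :
    ∃ c : Fin n ⊕ Fin n → F, x - ∑ k, c k • rankOneOp f (b k) (b k) ∈ altSub halt := by
  refine ⟨fun k => f (x (b k.swap)) (b k.swap), (mem_altSub_iff_of_basis b halt).2 ⟨?_, fun i => ?_⟩⟩
  · exact sub_mem hx (sum_mem fun k _ => (lieOf f).smul_mem _ (rankOneOp_self_mem_lieOf halt _))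
  · simp only [LinearMap.sub_apply, LinearMap.sum_apply, LinearMap.smul_apply, map_sub, map_sum,
      map_smul, rankOneOp_apply, hb.apply, smul_eq_mul, mul_ite, mul_one, mul_zero]
    rw [Finset.sum_eq_single i.swap (fun k _ hk => ?_) (by simp)]
    · simp
    · rw [if_neg]
      rintro rfl
      simp at hk

/-! ### The submodule spanned by the `wedgeOp`s of orthogonal vectors -/

/-- The span of the operators `wedgeOp f v w` with `f v w = 0`. -/
def perpSpan (f : LinearMap.BilinForm F V) : Submodule F (End F V) :=
  Submodule.span F {y | ∃ v w, f v w = 0 ∧ y = wedgeOp f v w}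

omit [CharP F 2] in
theorem wedgeOp_mem_perpSpan {v w : V} (h : f v w = 0) : wedgeOp f v w ∈ perpSpan f :=
  Submodule.subset_span ⟨v, w, h, rfl⟩

theorem perpSpan_le_altSub (halt : f.IsAlt) : perpSpan f ≤ (altSub halt).toSubmodule := by
  refine Submodule.span_le.2 ?_
  rintro _ ⟨v, w, -, rfl⟩
  exact wedgeOp_mem_altSub halt v w

omit [CharP F 2] in
/-- Modulo `perpSpan f`, the operator `wedgeOp f v w` depends on `f v w` only: it does not change
when `w` is replaced by a vector pairing in the same way with `v`, and two such replacements
lead from any pair to any other one. -/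
theorem wedgeOp_sub_wedgeOp_mem_perpSpan [FiniteDimensional F V] (hf : f.Nondegenerate)
    {v w p q : V} (h : f v w = f p q) : wedgeOp f v w - wedgeOp f p q ∈ perpSpan f := by
  have hright {v w r : V} (h : f v w = f v r) : wedgeOp f v w - wedgeOp f v r ∈ perpSpan f := by
    rw [← map_sub]
    exact wedgeOp_mem_perpSpan (by rw [map_sub, h, sub_self])
  have hleft {v p r : V} (h : f v r = f p r) : wedgeOp f v r - wedgeOp f p r ∈ perpSpan f := by
    rw [← LinearMap.sub_apply, ← map_sub]
    exact wedgeOp_mem_perpSpan (by rw [map_sub, LinearMap.sub_apply, h, sub_self])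
  by_cases h0 : f v w = 0
  · exact Submodule.sub_mem _ (wedgeOp_mem_perpSpan h0) (wedgeOp_mem_perpSpan (h ▸ h0))
  have hv : v ≠ 0 := by
    rintro rfl
    simp at h0
  by_cases hp : p ∈ Submodule.span F {v}
  · obtain ⟨d, rfl⟩ := Submodule.mem_span_singleton.1 hp
    rw [map_smul, LinearMap.smul_apply, ← map_smul]
    exact hright (by rw [h]; simp)
  · obtain ⟨r, hr, hrp⟩ := hf.flip.exists_apply_eq_one hp
    obtain ⟨s, hs, hsv⟩ := hf.flip.exists_apply_eq_one (notMem_span_singleton_comm hv hp)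
    replace hrp : f p r = 1 := hrp
    replace hsv : f v s = 1 := hsv
    have hrv : f v r = 0 := hr v (Submodule.mem_span_singleton_self v)
    have hsp : f p s = 0 := hs p (Submodule.mem_span_singleton_self p)
    let t : V := f v w • (r + s)
    have hvt : f v w = f v t := by simp [t, hrv, hsv]
    have hpt : f v w = f p t := by simp [t, hrp, hsp]
    have := Submodule.add_mem _ (Submodule.add_mem _ (hright hvt) (hleft (hvt.symm.trans hpt)))
      (hright (hpt.symm.trans h))
    simpa using this

omit [CharP F 2] in
theorem lie_mem_perpSpan [FiniteDimensional F V] (hf : f.Nondegenerate) {x : End F V}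
    (hx : x ∈ lieOf f) {y : End F V} (hy : y ∈ Submodule.span F {y | ∃ v w, y = wedgeOp f v w}) :
    ⁅x, y⁆ ∈ perpSpan f := by
  induction hy using Submodule.span_induction with
  | mem y hy =>
    obtain ⟨v, w, rfl⟩ := hy
    have h := wedgeOp_sub_wedgeOp_mem_perpSpan hf (v := x v) (w := w) (p := v) (q := -x w)
      (by rw [map_neg]; exact (mem_lieOf f x).1 hx v w)
    rwa [map_neg, sub_neg_eq_add, ← lie_wedgeOp hx] at h
  | zero => simp
  | add y z _ _ hy hz => rw [lie_add]; exact add_mem hy hz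
  | smul c y _ hy => rw [lie_smul]; exact Submodule.smul_mem _ c hy

/-- The `L(f)`-submodule `perpSpan f` of `gl(V)`. -/
def perpSub [FiniteDimensional F V] (hf : f.Nondegenerate) :
    LieSubmodule F (lieOf f) (End F V) where
  __ := perpSpan f
  lie_mem := by
    rintro ⟨x, hx⟩ y hy
    refine lie_mem_perpSpan hf hx (Submodule.span_mono ?_ hy)
    rintro _ ⟨v, w, -, rfl⟩
    exact ⟨v, w, rfl⟩

end Operators

/-! ### The derived series of `L(f)` -/

section Derived

variable {F V : Type*} [Field F] [AddCommGroup V] [Module F V] {f : LinearMap.BilinForm F V}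

theorem mem_perpSub [FiniteDimensional F V] {hf : f.Nondegenerate} {x : End F V} :
    x ∈ perpSub hf ↔ x ∈ perpSpan f := Iff.rfl

theorem mem_derivedSub {k : ℕ} {x : End F V} :
    x ∈ derivedSub f k ↔ ∃ y ∈ derivedIdeal f k, (y : End F V) = x := by
  rw [derivedSub, LieSubmodule.mem_map]
  rfl

theorem coe_mem_derivedSub {k : ℕ} {x : lieOf f} :
    (x : End F V) ∈ derivedSub f k ↔ x ∈ derivedIdeal f k := by
  rw [mem_derivedSub]
  exact ⟨fun ⟨y, hy, h⟩ => Subtype.ext h ▸ hy, fun h => ⟨x, h, rfl⟩⟩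

theorem derivedSub_le_lieSub (k : ℕ) : derivedSub f k ≤ lieSub f := by
  intro x hx
  obtain ⟨y, -, rfl⟩ := mem_derivedSub.1 hx
  exact y.2

theorem derivedSub_zero : derivedSub f 0 = lieSub f :=
  le_antisymm (derivedSub_le_lieSub 0) fun x hx =>
    mem_derivedSub.2 ⟨⟨x, hx⟩, by simp [derivedIdeal], rfl⟩

theorem lie_mem_derivedSub_succ {k : ℕ} {x y : End F V} (hx : x ∈ derivedSub f k)
    (hy : y ∈ derivedSub f k) : ⁅x, y⁆ ∈ derivedSub f (k + 1) := by
  obtain ⟨x, hx', rfl⟩ := mem_derivedSub.1 hx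
  obtain ⟨y, hy', rfl⟩ := mem_derivedSub.1 hy
  refine mem_derivedSub.2 ⟨⁅x, y⁆, ?_, rfl⟩
  rw [derivedIdeal, LieAlgebra.derivedSeries_def, LieAlgebra.derivedSeriesOfIdeal_succ]
  exact LieSubmodule.lie_mem_lie hx' hy'

theorem derivedSub_succ_le {k : ℕ} {N : LieSubmodule F (lieOf f) (End F V)}
    (h : ∀ x ∈ derivedSub f k, ∀ y ∈ derivedSub f k, ⁅x, y⁆ ∈ N) : derivedSub f (k + 1) ≤ N := by
  have h1 : derivedIdeal f (k + 1) ≤ LieSubmodule.comap (lieOf f).incl' N := by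
    rw [derivedIdeal, LieAlgebra.derivedSeries_def, LieAlgebra.derivedSeriesOfIdeal_succ,
      LieSubmodule.lie_le_iff]
    exact fun x hx y hy => h x (mem_derivedSub.2 ⟨x, hx, rfl⟩) y (mem_derivedSub.2 ⟨y, hy, rfl⟩)
  intro x hx
  obtain ⟨y, hy, rfl⟩ := mem_derivedSub.1 hx
  exact h1 hy

/-- The trace of the upper left block of the matrix of an operator relative to a symplectic
basis. -/
noncomputable def halfTrace {n : ℕ} (f : LinearMap.BilinForm F V) (b : Basis (Fin n ⊕ Fin n) F V) :
    End F V →ₗ[F] F where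
  toFun x := ∑ i, f (x (b (Sum.inl i))) (b (Sum.inr i))
  map_add' x y := by simp [Finset.sum_add_distrib]
  map_smul' c x := by simp [Finset.mul_sum]

theorem halfTrace_apply {n : ℕ} (b : Basis (Fin n ⊕ Fin n) F V) (x : End F V) :
    halfTrace f b x = ∑ i, f (x (b (Sum.inl i))) (b (Sum.inr i)) := rfl

variable [CharP F 2] [FiniteDimensional F V] {n : ℕ} {b : Basis (Fin n ⊕ Fin n) F V}

omit [FiniteDimensional F V] in
theorem halfTrace_wedgeOp (hb : IsSymplecticBasis f b) (halt : f.IsAlt) (v w : V) :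
    halfTrace f b (wedgeOp f v w) = f v w := by
  rw [halfTrace_apply]
  have hv : f v w = ∑ i, b.repr v i * f (b i) w := by
    conv_lhs => rw [← b.sum_repr v]
    simp only [map_sum, map_smul, LinearMap.sum_apply, LinearMap.smul_apply, smul_eq_mul]
  rw [hv]
  simp only [map_smul, LinearMap.smul_apply, smul_eq_mul,
    hb.repr_apply, Fintype.sum_sum_type, Sum.swap_inl, Sum.swap_inr, wedgeOp_apply, map_sub,
    LinearMap.sub_apply, Finset.sum_sub_distrib]
  rw [CharTwo.sub_eq_add]
  refine congrArg₂ (· + ·) (Finset.sum_congr rfl fun i _ => ?_) (Finset.sum_congr rfl fun i _ => ?_)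
  · rw [halt.apply_comm w, mul_comm]
  · rw [halt.apply_comm w]

omit [FiniteDimensional F V] in
theorem halfTrace_eq_zero_of_mem_perpSpan (hb : IsSymplecticBasis f b) (halt : f.IsAlt)
    {x : End F V} (hx : x ∈ perpSpan f) : halfTrace f b x = 0 := by
  have h : perpSpan f ≤ LinearMap.ker (halfTrace f b) := by
    refine Submodule.span_le.2 ?_
    rintro _ ⟨v, w, h, rfl⟩
    exact LinearMap.mem_ker.2 ((halfTrace_wedgeOp hb halt v w).trans h)
  exact h hx

theorem mem_perpSpan_iff (hf : f.Nondegenerate) (hb : IsSymplecticBasis f b) (halt : f.IsAlt)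
    (hn : 0 < n) {x : End F V} :
    x ∈ perpSpan f ↔ x ∈ altSub halt ∧ halfTrace f b x = 0 := by
  refine ⟨fun hx => ⟨perpSpan_le_altSub halt hx, halfTrace_eq_zero_of_mem_perpSpan hb halt hx⟩, ?_⟩
  rintro ⟨hx, h0⟩
  let p : V := b (Sum.inl ⟨0, hn⟩)
  let q : V := b (Sum.inr ⟨0, hn⟩)
  have hpq : f p q = 1 := by simp [p, q, hb.apply]
  have key : ∀ y ∈ Submodule.span F {y | ∃ v w, y = wedgeOp f v w},
      y - halfTrace f b y • wedgeOp f p q ∈ perpSpan f := by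
    intro y hy
    induction hy using Submodule.span_induction with
    | mem y hy =>
      obtain ⟨v, w, rfl⟩ := hy
      rw [halfTrace_wedgeOp hb halt, ← LinearMap.smul_apply, ← map_smul]
      exact wedgeOp_sub_wedgeOp_mem_perpSpan hf (by simp [hpq])
    | zero => simp
    | add y z _ _ hy hz =>
      rw [map_add, add_smul, add_sub_add_comm]
      exact add_mem hy hz
    | smul c y _ hy =>
      rw [map_smul, smul_eq_mul, mul_smul, ← smul_sub]
      exact Submodule.smul_mem _ c hy
  simpa [h0] using key x (mem_span_wedgeOp hb halt hx)

theorem derivedSub_one (hf : f.Nondegenerate) (hb : IsSymplecticBasis f b) (halt : f.IsAlt) :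
    derivedSub f 1 = altSub halt := by
  refine le_antisymm (derivedSub_succ_le fun x hx y hy => ?_) ?_
  · exact lie_mem_altSub halt (derivedSub_le_lieSub 0 hx) (derivedSub_le_lieSub 0 hy)
  have hne {v w : V} (h : f v w ≠ 0) : wedgeOp f v w ∈ derivedSub f 1 := by
    have hmem (u : V) : rankOneOp f u u ∈ derivedSub f 0 := by
      rw [derivedSub_zero]
      exact rankOneOp_self_mem_lieOf halt u
    have h1 := lie_mem_derivedSub_succ (hmem v) (hmem w)
    rw [lie_rankOneOp (rankOneOp_self_mem_lieOf halt v), rankOneOp_apply, map_smul, map_smul,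
      LinearMap.smul_apply, ← smul_add, ← sub_eq_add_of_charTwo F] at h1
    have h2 := (derivedSub f 1).smul_mem (f v w)⁻¹ h1
    rwa [smul_smul, inv_mul_cancel₀ h, one_smul] at h2
  have hall (v w : V) : wedgeOp f v w ∈ derivedSub f 1 := by
    by_cases h : f v w = 0
    · by_cases hv : v = 0
      · rw [hv, map_zero]
        exact (derivedSub f 1).zero_mem
      · obtain ⟨u, -, hu⟩ := hf.exists_apply_eq_one (W := ⊥) hv
        rw [halt.apply_comm] at hu
        have h1 : wedgeOp f v w = wedgeOp f v (w + u) - wedgeOp f v u := by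
          rw [map_add, add_sub_cancel_right]
        rw [h1]
        refine sub_mem (hne ?_) (hne ?_)
        · rw [map_add, h, hu, zero_add]
          exact one_ne_zero
        · rw [hu]
          exact one_ne_zero
    · exact hne h
  intro x hx
  have hle : Submodule.span F {y | ∃ v w, y = wedgeOp f v w} ≤ (derivedSub f 1).toSubmodule := by
    refine Submodule.span_le.2 ?_
    rintro _ ⟨v, w, rfl⟩
    exact hall v w
  exact hle (mem_span_wedgeOp hb halt hx)

theorem derivedSub_two (hf : f.Nondegenerate) (hb : IsSymplecticBasis f b) (halt : f.IsAlt)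
    (hn : 0 < n) : derivedSub f 2 = perpSub hf := by
  refine le_antisymm (derivedSub_succ_le fun x hx y hy => ?_) ?_
  · rw [derivedSub_one hf hb halt] at hy
    exact lie_mem_perpSpan hf (derivedSub_le_lieSub 1 hx)
      (mem_span_wedgeOp hb halt hy)
  have hdim : finrank F V = n + n := by simpa using finrank_eq_card_basis b
  rcases Nat.eq_or_lt_of_le (Nat.succ_le_of_lt hn) with h1 | h1
  · obtain rfl : n = 1 := by omega
    intro x hx
    obtain ⟨hx, h0⟩ := (mem_perpSpan_iff hf hb halt hn).1 hx
    rw [halfTrace_apply, Fin.sum_univ_one] at h0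
    have hL := (mem_lieOf_iff_of_basis b halt).1 (altSub_le_lieSub halt hx)
    have hx0 : x = 0 := hb.ext_op fun i j => by
      rw [LinearMap.zero_apply, map_zero, LinearMap.zero_apply]
      rcases i with i | i <;> rcases j with j | j <;> rw [Subsingleton.elim i 0, Subsingleton.elim j 0]
      · exact hx _
      · exact h0
      · rw [hL]
        exact h0
      · exact hx _
    rw [hx0]
    exact zero_mem _
  · have hle : perpSpan f ≤ (derivedSub f 2).toSubmodule := by
      refine Submodule.span_le.2 ?_
      rintro _ ⟨u, w, huw, rfl⟩
      have hw := finrank_span_singleton_le_one (F := F) w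
      obtain ⟨z, hz, hzw, -⟩ := f.exists_orthogonal_notMem ![u]
        (W₁ := Submodule.span F {w}) (W₂ := Submodule.span F {w}) (by omega) (by omega)
      replace hz : f z u = 0 := hz 0
      obtain ⟨a, ha, haz⟩ := hf.exists_apply_eq_one hzw
      have haw : f a w = 0 := ha w (Submodule.mem_span_singleton_self w)
      have hmem (p q : V) : wedgeOp f p q ∈ derivedSub f 1 := by
        rw [derivedSub_one hf hb halt]
        exact wedgeOp_mem_altSub halt p q
      have h := lie_mem_derivedSub_succ (hmem u a) (hmem z w)
      rw [lie_wedgeOp (mem_lieOf_of_forall_apply_self halt (wedgeOp_mem_altSub halt u a)),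
        wedgeOp_apply, wedgeOp_apply, haz, halt.apply_comm u z, hz, haw, huw] at h
      simpa using h
    exact hle

end Derived

/-! ### Submodules containing a non-scalar alternating operator -/

section Irreducible

variable {F V : Type*} [Field F] [AddCommGroup V] [Module F V] [FiniteDimensional F V]
  {f : LinearMap.BilinForm F V}

theorem exists_orthogonal_apply_ne_zero (hf : f.Nondegenerate) {x : End F V}
    (hx : ∀ c : F, x ≠ c • 1) : ∃ a b, f b a = 0 ∧ f b (x a) ≠ 0 := by
  by_contra! hcon
  obtain ⟨c, hc⟩ := LinearMap.exists_eq_smul_id_of_forall_notLinearIndependent (f := x) (by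
    intro a hind
    have ha : x a ∉ Submodule.span F {a} := by
      intro hmem
      obtain ⟨c, hc⟩ := Submodule.mem_span_singleton.1 hmem
      have := LinearIndependent.pair_iff.1 hind c (-1) (by rw [hc]; simp)
      simpa using this.2
    obtain ⟨r, hr, hr1⟩ := hf.exists_apply_eq_one ha
    exact one_ne_zero (hr1.symm.trans (hcon a r (hr a (Submodule.mem_span_singleton_self a)))))
  exact hx c hc

variable [CharP F 2]

/-- If a subspace contains a `wedgeOp` of two independent orthogonal vectors, and if in all such
`wedgeOp`s in it one vector may be replaced by any vector orthogonal to the other, then the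
subspace contains `perpSpan f`: two orthogonal pairs are joined by such replacements. -/
theorem perpSpan_le_of_replace (halt : f.IsAlt) (hdim : 4 ≤ finrank F V)
    {K : Submodule F (End F V)}
    (hK : ∀ u v w, v ≠ 0 → u ∉ Submodule.span F {v} → f u v = 0 → wedgeOp f u v ∈ K →
      f w v = 0 → w ∉ Submodule.span F {v} → wedgeOp f w v ∈ K)
    {u v : V} (hv : v ≠ 0) (hu : u ∉ Submodule.span F {v}) (huv : f u v = 0)
    (hmem : wedgeOp f u v ∈ K) : perpSpan f ≤ K := by
  have hK' (u v w : V) (hv : v ≠ 0) (hu : u ∉ Submodule.span F {v}) (huv : f u v = 0)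
      (hmem : wedgeOp f u v ∈ K) (hwv : f w v = 0) : wedgeOp f w v ∈ K := by
    by_cases hw : w ∈ Submodule.span F {v}
    · rw [wedgeOp_eq_zero_of_mem_span hw]
      exact K.zero_mem
    · exact hK u v w hv hu huv hmem hwv hw
  have hflip {p q : V} (h : wedgeOp f p q ∈ K) : wedgeOp f q p ∈ K := by
    rw [wedgeOp_swap]
    exact K.neg_mem h
  refine Submodule.span_le.2 ?_
  rintro _ ⟨w, w', hww, rfl⟩
  by_cases hw' : w' = 0
  · rw [hw', map_zero]
    exact K.zero_mem
  have h1 := finrank_span_singleton_le_one (F := F) v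
  have h2 := finrank_span_singleton_le_one (F := F) w'
  obtain ⟨z, hz, hzv, hzw⟩ := f.exists_orthogonal_notMem ![v, w']
    (W₁ := Submodule.span F {v}) (W₂ := Submodule.span F {w'}) (by omega) (by omega)
  have hzv0 : f z v = 0 := hz 0
  have hzw0 : f z w' = 0 := hz 1
  have hz0 : z ≠ 0 := by
    rintro rfl
    exact hzv (zero_mem _)
  have h3 := hflip (hK' u v z hv hu huv hmem hzv0)
  have h4 := hflip (hK' v z w' hz0 (notMem_span_singleton_comm hv hzv)
    (by rw [halt.apply_comm, hzv0]) h3 (by rw [halt.apply_comm, hzw0]))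
  exact hK' z w' w hw' hzw hzw0 h4 hww

/-- An `L(f)`-submodule of `gl(V)` containing a non-scalar alternating operator contains
`perpSub hf`: apply the operators `u ↦ f a u • a`. -/
theorem perpSub_le_of_mem (hf : f.Nondegenerate) (halt : f.IsAlt) (hdim : 4 ≤ finrank F V)
    {K : LieSubmodule F (lieOf f) (End F V)} {x : End F V} (hxK : x ∈ K) (hx : x ∈ altSub halt)
    (hns : ∀ c : F, x ≠ c • 1) : perpSub hf ≤ K := by
  have hlie (a : V) {y : End F V} (hy : y ∈ K) : ⁅rankOneOp f a a, y⁆ ∈ K :=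
    K.lie_mem (x := ⟨_, rankOneOp_self_mem_lieOf halt a⟩) hy
  have hcancel {c : F} (hc : c ≠ 0) {y : End F V} (hy : c • y ∈ K) : y ∈ K := by
    have := K.smul_mem c⁻¹ hy
    rwa [smul_smul, inv_mul_cancel₀ hc, one_smul] at this
  have happly (a v w : V) : ⁅rankOneOp f a a, wedgeOp f v w⁆ =
      f a v • wedgeOp f a w + f a w • wedgeOp f v a := by
    rw [lie_wedgeOp (rankOneOp_self_mem_lieOf halt a), rankOneOp_apply, rankOneOp_apply, map_smul,
      map_smul, LinearMap.smul_apply]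
  obtain ⟨a, b, hba, hbxa⟩ := exists_orthogonal_apply_ne_zero hf hns
  have h1 : wedgeOp f b a ∈ K := by
    have h2 := hlie b (hlie a hxK)
    rw [← lie_skew (rankOneOp f a a) x, lie_rankOneOp (mem_lieOf_of_forall_apply_self halt hx),
      ← sub_eq_add_of_charTwo F, ← wedgeOp_eq, lie_neg, happly, hba, zero_smul, add_zero,
      ← smul_neg, neg_eq_self_of_charTwo F] at h2
    exact hcancel hbxa h2
  have ha : a ≠ 0 := by
    rintro rfl
    simp at hbxa
  have hb : b ∉ Submodule.span F {a} := by
    intro h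
    obtain ⟨c, rfl⟩ := Submodule.mem_span_singleton.1 h
    rw [map_smul, LinearMap.smul_apply, halt.apply_comm, hx a, smul_zero] at hbxa
    exact hbxa rfl
  refine perpSpan_le_of_replace halt hdim ?_ ha hb hba h1
  intro u v w hv hu huv hmem hwv hw
  obtain ⟨c, hcv, hcu, hcw⟩ := hf.exists_apply_ne_zero hu hw
  have h2 := hlie c hmem
  rw [happly, hcv, zero_smul, add_zero] at h2
  have h3 := hlie w (hcancel hcu h2)
  rw [happly, hwv, zero_smul, add_zero, halt.apply_comm] at h3
  exact hcancel hcw h3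

/-- A subspace of `gl(V)` stable under `perpSpan f` and containing a non-scalar alternating
operator contains `perpSpan f`, provided that `dim V > 4`. -/
theorem perpSpan_le_of_mem (hf : f.Nondegenerate) (halt : f.IsAlt) (hdim : 6 ≤ finrank F V)
    {K : Submodule F (End F V)} (hK : ∀ y ∈ perpSpan f, ∀ z ∈ K, ⁅y, z⁆ ∈ K)
    {x : End F V} (hxK : x ∈ K) (hx : x ∈ altSub halt)
    (hns : ∀ c : F, x ≠ c • 1) : perpSpan f ≤ K := by
  have hlie {p q : V} (hpq : f p q = 0) {y : End F V} (hy : y ∈ K) : ⁅wedgeOp f p q, y⁆ ∈ K :=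
    hK _ (wedgeOp_mem_perpSpan hpq) y hy
  have happly (p q v w : V) : ⁅wedgeOp f p q, wedgeOp f v w⁆ =
      wedgeOp f (f q v • p - f p v • q) w + wedgeOp f v (f q w • p - f p w • q) :=
    lie_wedgeOp (mem_lieOf_of_forall_apply_self halt (wedgeOp_mem_altSub halt p q)) v w
  obtain ⟨a, b, hba, hbxa⟩ := exists_orthogonal_apply_ne_zero hf hns
  have hb : b ≠ 0 := by
    rintro rfl
    simp at hbxa
  have h2 := finrank_span_pair_le_two (F := F) a b
  obtain ⟨c, hc, hcab, -⟩ := f.exists_orthogonal_notMem ![a, b]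
    (W₁ := Submodule.span F {a, b}) (W₂ := Submodule.span F {a, b}) (by omega) (by omega)
  have hca : f c a = 0 := hc 0
  have hcb : f c b = 0 := hc 1
  -- The double bracket of `x` with `b ∧ a` and then `c ∧ b` is `u ∧ b` for a vector `u`
  -- orthogonal to and independent of `b`.
  have h1 : wedgeOp f (f b (x a) • c - f c (x b) • a) b ∈ K := by
    have h3 := hlie hcb (hlie hba hxK)
    rw [← lie_skew (wedgeOp f b a) x, lie_neg,
      lie_wedgeOp (mem_lieOf_of_forall_apply_self halt hx), lie_add,
      happly, happly, hba, hcb, hca, halt b, halt.apply_comm b (x b), hx b] at h3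
    convert h3 using 1
    simp only [map_sub, map_smul, LinearMap.sub_apply, LinearMap.smul_apply, wedgeOp_self]
    rw [wedgeOp_swap f b a, wedgeOp_swap f b c]
    module
  have hu : f b (x a) • c - f c (x b) • a ∉ Submodule.span F {b} := by
    intro h
    obtain ⟨d, hd⟩ := Submodule.mem_span_singleton.1 h
    refine hcab (Submodule.mem_span_pair.2
      ⟨(f b (x a))⁻¹ * f c (x b), (f b (x a))⁻¹ * d, ?_⟩)
    rw [mul_smul, mul_smul, hd, ← smul_add, add_sub_cancel, smul_smul, inv_mul_cancel₀ hbxa,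
      one_smul]
  have hub : f (f b (x a) • c - f c (x b) • a) b = 0 := by
    rw [map_sub, map_smul, map_smul, LinearMap.sub_apply, LinearMap.smul_apply,
      LinearMap.smul_apply, hcb, halt.apply_comm a b, hba, smul_zero, smul_zero, sub_zero]
  refine perpSpan_le_of_replace halt (by omega) ?_ hb hu hub h1
  have hstep (u v w : V) (hu : u ∉ Submodule.span F {v}) (huv : f u v = 0)
      (hmem : wedgeOp f u v ∈ K) (hwu : f w u = 0) (hwv : f w v = 0)
      (hw : w ∉ Submodule.span F {u, v}) : wedgeOp f w v ∈ K := by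
    obtain ⟨s, hs, hsu⟩ := hf.exists_apply_eq_one (notMem_span_pair_of_notMem_span_pair hu hw)
    have hsv : f s v = 0 := hs v (Submodule.subset_span (by simp))
    have hsw : f s w = 0 := hs w (Submodule.subset_span (by simp))
    have h := hlie (by rw [halt.apply_comm, hsw]) hmem (p := w) (q := s)
    rw [happly, hsu, hwu, hsv, hwv] at h
    simpa using h
  intro u v w hv hu huv hmem hwv hw
  have h4 := finrank_span_pair_le_two (F := F) u v
  have h5 := finrank_span_pair_le_two (F := F) w v
  obtain ⟨z, hz, hzuv, hzwv⟩ := f.exists_orthogonal_notMem ![u, v, w]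
    (W₁ := Submodule.span F {u, v}) (W₂ := Submodule.span F {w, v}) (by omega) (by omega)
  have hzu0 : f z u = 0 := hz 0
  have hzv0 : f z v = 0 := hz 1
  have hzw0 : f z w = 0 := hz 2
  have hzv : z ∉ Submodule.span F {v} :=
    fun h => hzuv (Submodule.span_mono (by simp) h)
  refine hstep z v w hzv hzv0 (hstep u v z hu huv hmem hzu0 hzv0 hzuv)
    (by rw [halt.apply_comm, hzw0]) hwv ?_
  rw [Set.pair_comm]
  exact notMem_span_pair_of_notMem_span_pair hw hzwv

end Irreducible

/-! ### Equivalences of Lie modules with the same image -/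

section Equivalences

variable {F L M : Type*} [CommRing F] [LieRing L] [AddCommGroup M] [Module F M]
  [LieRingModule L M] {A B : Type*} [AddCommGroup A] [Module F A] [LieRingModule L A]
  [AddCommGroup B] [Module F B] [LieRingModule L B]

theorem LieModuleHom.nonempty_quot_equiv_range [LieAlgebra F L] [LieModule F L A]
    (N : LieSubmodule F L A) (g : A →ₗ⁅F,L⁆ M)
    (hg : ∀ x, g x = 0 ↔ x ∈ N) : Nonempty ((A ⧸ N) ≃ₗ⁅F,L⁆ g.range) := by
  let g' : A →ₗ⁅F,L⁆ g.range :=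
    { LinearMap.codRestrict g.range.toSubmodule (g : A →ₗ[F] M)
        (fun x => (LieModuleHom.mem_range g _).2 ⟨x, rfl⟩) with
      map_lie' := fun {x m} => Subtype.ext (g.map_lie x m) }
  refine ⟨LieModuleHom.quotEquivOfSurjective N g' (fun x => ?_) ?_⟩
  · rw [← hg]
    exact Subtype.ext_iff
  · rintro ⟨y, hy⟩
    obtain ⟨x, rfl⟩ := (LieModuleHom.mem_range g _).1 hy
    exact ⟨x, rfl⟩

theorem LieModuleHom.nonempty_equiv_range (g : A →ₗ⁅F,L⁆ M) (hg : Function.Injective g) :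
    Nonempty (A ≃ₗ⁅F,L⁆ g.range) := by
  let g' : A →ₗ⁅F,L⁆ g.range :=
    { LinearMap.codRestrict g.range.toSubmodule (g : A →ₗ[F] M)
        (fun x => (LieModuleHom.mem_range g _).2 ⟨x, rfl⟩) with
      map_lie' := fun {x m} => Subtype.ext (g.map_lie x m) }
  refine ⟨LieModuleEquiv.ofBijectiveHom g' ⟨fun x y h => hg (congrArg Subtype.val h), ?_⟩⟩
  rintro ⟨y, hy⟩
  obtain ⟨x, rfl⟩ := (LieModuleHom.mem_range g _).1 hy
  exact ⟨x, rfl⟩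

theorem nonempty_lieModuleEquiv_of_range_eq (g : A →ₗ⁅F,L⁆ M) (h : B →ₗ⁅F,L⁆ M)
    (hg : Function.Injective g) (hh : Function.Injective h) (hr : g.range = h.range) :
    Nonempty (A ≃ₗ⁅F,L⁆ B) := by
  obtain ⟨e⟩ := g.nonempty_equiv_range hg
  obtain ⟨e'⟩ := h.nonempty_equiv_range hh
  rw [← hr] at e'
  exact ⟨e.trans e'.symm⟩

theorem nonempty_lieModuleEquiv_quot_of_range_eq [LieAlgebra F L] [LieModule F L B]
    (N : LieSubmodule F L B) (g : A →ₗ⁅F,L⁆ M) (h : B →ₗ⁅F,L⁆ M)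
    (hg : Function.Injective g) (hh : ∀ x, h x = 0 ↔ x ∈ N) (hr : g.range = h.range) :
    Nonempty (A ≃ₗ⁅F,L⁆ (B ⧸ N)) := by
  obtain ⟨e⟩ := g.nonempty_equiv_range hg
  obtain ⟨e'⟩ := h.nonempty_quot_equiv_range N hh
  rw [← hr] at e'
  exact ⟨e.trans e'.symm⟩

theorem nonempty_quot_lieModuleEquiv_quot_of_range_eq [LieAlgebra F L] [LieModule F L A]
    [LieModule F L B] (N : LieSubmodule F L A) (N' : LieSubmodule F L B)
    (g : A →ₗ⁅F,L⁆ M) (h : B →ₗ⁅F,L⁆ M)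
    (hg : ∀ x, g x = 0 ↔ x ∈ N) (hh : ∀ x, h x = 0 ↔ x ∈ N') (hr : g.range = h.range) :
    Nonempty ((A ⧸ N) ≃ₗ⁅F,L⁆ (B ⧸ N')) := by
  obtain ⟨e⟩ := g.nonempty_quot_equiv_range N hg
  obtain ⟨e'⟩ := h.nonempty_quot_equiv_range N' hh
  rw [← hr] at e'
  exact ⟨e.trans e'.symm⟩

end Equivalences

/-! ### The map `x ↦ x - x*` -/

section AltPart

variable {F V : Type*} [Field F] [AddCommGroup V] [Module F V] [FiniteDimensional F V]
  {f : LinearMap.BilinForm F V}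

omit [FiniteDimensional F V] in
theorem ext_of_forall_apply (hf : f.Nondegenerate) {x y : End F V}
    (h : ∀ v w, f (x v) w = f (y v) w) : x = y := by
  ext v
  exact LinearMap.ker_eq_bot.1 hf.ker_eq_bot (LinearMap.ext (h v))

/-- The homomorphism `x ↦ x - x*` of `L(f)`-modules, where `x*` is the adjoint of `x` for `f`. -/
noncomputable def altPart (hf : f.Nondegenerate) : End F V →ₗ⁅F, lieOf f⁆ End F V :=
  have key (x : End F V) (v w : V) : f ((x - f.leftAdjointOfNondegenerate hf x) v) w =
      f (x v) w - f v (x w) := by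
    rw [LinearMap.sub_apply, map_sub, LinearMap.sub_apply,
      f.isAdjointPairLeftAdjointOfNondegenerate hf x v w]
  { toFun := fun x => x - f.leftAdjointOfNondegenerate hf x
    map_add' := fun x y => ext_of_forall_apply hf fun v w => by
      rw [LinearMap.add_apply, map_add, LinearMap.add_apply, key, key, key]
      simp only [LinearMap.add_apply, map_add]
      ring
    map_smul' := fun c x => ext_of_forall_apply hf fun v w => by
      rw [LinearMap.smul_apply, map_smul, LinearMap.smul_apply, key, key]
      simp only [LinearMap.smul_apply, map_smul, RingHom.id_apply, smul_sub]
    map_lie' := by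
      rintro ⟨y, hy⟩ x
      rw [mem_lieOf] at hy
      refine ext_of_forall_apply hf fun v w => ?_
      change f ((⁅y, x⁆ - f.leftAdjointOfNondegenerate hf ⁅y, x⁆) v) w =
        f (⁅y, x - f.leftAdjointOfNondegenerate hf x⁆ v) w
      rw [key, LieRing.of_associative_ring_bracket, LieRing.of_associative_ring_bracket,
        LinearMap.sub_apply, LinearMap.sub_apply, LinearMap.sub_apply, End.mul_apply,
        End.mul_apply, End.mul_apply, End.mul_apply, End.mul_apply, End.mul_apply, map_sub,
        map_sub, map_sub, LinearMap.sub_apply, LinearMap.sub_apply, key, hy, hy, key]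
      have := hy v (x w)
      rw [this]
      ring }

theorem apply_altPart (hf : f.Nondegenerate) (x : End F V) (v w : V) :
    f (altPart hf x v) w = f (x v) w - f v (x w) := by
  change f ((x - f.leftAdjointOfNondegenerate hf x) v) w = _
  rw [LinearMap.sub_apply, map_sub, LinearMap.sub_apply,
    f.isAdjointPairLeftAdjointOfNondegenerate hf x v w]

variable [CharP F 2]

theorem altPart_eq_zero_iff {hf : f.Nondegenerate} {x : End F V} :
    altPart hf x = 0 ↔ x ∈ lieOf f := by
  rw [mem_lieOf]
  constructor
  · intro h v w
    have h1 := apply_altPart hf x v w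
    rw [h, LinearMap.zero_apply, map_zero, LinearMap.zero_apply, eq_comm, sub_eq_zero] at h1
    rw [CharTwo.neg_eq, h1]
  · intro h
    refine ext_of_forall_apply hf fun v w => ?_
    rw [apply_altPart, h, CharTwo.neg_eq, sub_self, LinearMap.zero_apply, map_zero,
      LinearMap.zero_apply]

theorem altPart_rankOneOp (hf : f.Nondegenerate) (halt : f.IsAlt) (v w : V) :
    altPart hf (rankOneOp f v w) = wedgeOp f v w := by
  refine ext_of_forall_apply hf fun u u' => ?_
  rw [apply_altPart, wedgeOp_apply, rankOneOp_apply, rankOneOp_apply, map_sub, map_smul, map_smul,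
    map_smul, LinearMap.sub_apply, LinearMap.smul_apply, LinearMap.smul_apply, smul_eq_mul,
    smul_eq_mul, smul_eq_mul, halt.apply_comm u v, mul_comm (f w u')]

theorem altPart_mem_altSub (hf : f.Nondegenerate) (halt : f.IsAlt) (x : End F V) :
    altPart hf x ∈ altSub halt := fun u => by
  rw [apply_altPart, halt.apply_comm, sub_self]

variable {n : ℕ} {b : Basis (Fin n ⊕ Fin n) F V}

theorem range_altPart (hf : f.Nondegenerate) (hb : IsSymplecticBasis f b) (halt : f.IsAlt) :
    (altPart hf).range = altSub halt := by
  refine le_antisymm ?_ fun x hx => ?_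
  · intro y hy
    obtain ⟨x, rfl⟩ := (LieModuleHom.mem_range _ _).1 hy
    exact altPart_mem_altSub hf halt x
  · have hle : Submodule.span F {y | ∃ v w, y = wedgeOp f v w} ≤
        (altPart hf).range.toSubmodule := by
      refine Submodule.span_le.2 ?_
      rintro _ ⟨v, w, rfl⟩
      exact (LieModuleHom.mem_range _ _).2 ⟨_, altPart_rankOneOp hf halt v w⟩
    exact hle (mem_span_wedgeOp hb halt hx)

/-- The diagonal blocks of `x - x*` are `A + D'` and `A' + D`, where `A` and `D` are those of
`x`. -/
theorem halfTrace_altPart (hf : f.Nondegenerate) (hb : IsSymplecticBasis f b) (halt : f.IsAlt)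
    (x : End F V) : halfTrace f b (altPart hf x) = LinearMap.trace F V x := by
  rw [halfTrace_apply, LinearMap.trace_eq_matrix_trace F b, Matrix.trace]
  simp only [Matrix.diag_apply, LinearMap.toMatrix_apply, hb.repr_apply, Fintype.sum_sum_type,
    Sum.swap_inl, Sum.swap_inr, apply_altPart, Finset.sum_sub_distrib]
  rw [CharTwo.sub_eq_add]
  exact congrArg _ (Finset.sum_congr rfl fun i _ => halt.apply_comm _ _)

theorem altPart_halfIdentity (hf : f.Nondegenerate) (hb : IsSymplecticBasis f b) :
    altPart hf (halfIdentity b) = 1 := by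
  have hl (i : Fin n) : halfIdentity b (b (Sum.inl i)) = b (Sum.inl i) := by
    rw [halfIdentity, Matrix.toLin_self]
    simp [Fintype.sum_sum_type, Matrix.one_apply]
  have hr (i : Fin n) : halfIdentity b (b (Sum.inr i)) = 0 := by
    rw [halfIdentity, Matrix.toLin_self]
    simp [Fintype.sum_sum_type]
  refine hb.ext_op fun i j => ?_
  rw [apply_altPart, End.one_apply]
  rcases i with i | i <;> rcases j with j | j <;> simp [hl, hr, hb.apply, CharTwo.neg_eq]

omit [FiniteDimensional F V] in
theorem halfTrace_one (hb : IsSymplecticBasis f b) : halfTrace f b 1 = n := by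
  simp [halfTrace_apply, hb.apply]

end AltPart

/-! ### The isomorphism of `V ⊗ V` with `gl(V)` -/

section Tensor

-- The subalgebra `L(f)` of `gl(V)` acts on `V ⊗ V` both through `V` and through `gl(V)`; the first
-- of these two instances is the one with respect to which `symSquare` and `extSquare` are formed.
attribute [local instance 2000] TensorProduct.LieModule.lieRingModule
  TensorProduct.LieModule.lieModule

variable {F V : Type*} [Field F] [AddCommGroup V] [Module F V] {f : LinearMap.BilinForm F V}

/-- The homomorphism `v ⊗ w ↦ (u ↦ f w u • v)` of `L(f)`-modules from `V ⊗ V` to `gl(V)`. -/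
def tensorOp (f : LinearMap.BilinForm F V) : (V ⊗[F] V) →ₗ⁅F, lieOf f⁆ End F V :=
  { TensorProduct.lift (rankOneOp f) with
    map_lie' := by
      rintro x t
      change TensorProduct.lift (rankOneOp f) ⁅x, t⁆ =
        ⁅(x : End F V), TensorProduct.lift (rankOneOp f) t⁆
      induction t using TensorProduct.induction_on with
      | zero => simp
      | tmul v w =>
        refine (congrArg _ (TensorProduct.LieModule.lie_tmul_right x v w)).trans ?_
        rw [map_add, TensorProduct.lift.tmul, TensorProduct.lift.tmul, TensorProduct.lift.tmul,
          lie_rankOneOp x.2]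
        rfl
      | add s t hs ht =>
        refine (congrArg _ (lie_add x s t)).trans ?_
        rw [map_add, map_add, lie_add]
        exact congrArg₂ _ hs ht }

@[simp]
theorem tensorOp_tmul (v w : V) : tensorOp f (v ⊗ₜ w) = rankOneOp f v w :=
  TensorProduct.lift.tmul v w

variable [CharP F 2] [FiniteDimensional F V] {n : ℕ} {b : Basis (Fin n ⊕ Fin n) F V}

theorem tensorOp_injective (hb : IsSymplecticBasis f b) : Function.Injective (tensorOp f) := by
  have hfin : finrank F (V ⊗[F] V) = finrank F (End F V) := by
    rw [finrank_tensorProduct, finrank_linearMap]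
  refine (LinearMap.injective_iff_surjective_of_finrank_eq_finrank hfin
    (f := (tensorOp f : (V ⊗[F] V) →ₗ[F] End F V))).2 fun x => ?_
  refine ⟨∑ j, x (b j) ⊗ₜ b j.swap, ?_⟩
  rw [map_sum]
  refine b.ext fun i => ?_
  change (∑ j, tensorOp f (x (b j) ⊗ₜ b j.swap)) (b i) = x (b i)
  simp only [tensorOp_tmul, LinearMap.sum_apply, rankOneOp_apply, hb.apply,
    Sum.swap_swap, ite_smul, one_smul, zero_smul, Finset.sum_ite_eq, Finset.mem_univ, if_true]

omit [FiniteDimensional F V] in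
theorem map_tensorOp_extSquare (hb : IsSymplecticBasis f b) (halt : f.IsAlt) :
    LieSubmodule.map (tensorOp f) (extSquare F (lieOf f) V) = altSub halt := by
  refine le_antisymm ?_ fun x hx => ?_
  · rw [LieSubmodule.map_le_iff_le_comap]
    refine Submodule.span_le.2 ?_
    rintro _ ⟨v, w, rfl⟩
    change tensorOp f (v ⊗ₜ w - w ⊗ₜ v) ∈ altSub halt
    rw [map_sub, tensorOp_tmul, tensorOp_tmul, ← wedgeOp_eq]
    exact wedgeOp_mem_altSub halt v w
  · have hle : Submodule.span F {y | ∃ v w, y = wedgeOp f v w} ≤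
        (LieSubmodule.map (tensorOp f) (extSquare F (lieOf f) V)).toSubmodule := by
      refine Submodule.span_le.2 ?_
      rintro _ ⟨v, w, rfl⟩
      refine (LieSubmodule.mem_map _).2 ⟨_, (wedge F (lieOf f) v w).2, ?_⟩
      change tensorOp f (v ⊗ₜ w - w ⊗ₜ v) = _
      rw [map_sub, tensorOp_tmul, tensorOp_tmul, ← wedgeOp_eq]
    exact hle (mem_span_wedgeOp hb halt hx)

omit [FiniteDimensional F V] in
theorem map_tensorOp_symSquare (hb : IsSymplecticBasis f b) (halt : f.IsAlt) :
    LieSubmodule.map (tensorOp f) (symSquare F (lieOf f) V) = lieSub f := by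
  have hle : extSquare F (lieOf f) V ≤ symSquare F (lieOf f) V := by
    refine Submodule.span_le.2 ?_
    rintro _ ⟨v, w, rfl⟩
    rw [sub_eq_add_of_charTwo F]
    exact Submodule.subset_span (Or.inr ⟨v, w, rfl⟩)
  refine le_antisymm ?_ fun x hx => ?_
  · rw [LieSubmodule.map_le_iff_le_comap]
    refine Submodule.span_le.2 ?_
    rintro _ (⟨v, rfl⟩ | ⟨v, w, rfl⟩)
    · change tensorOp f (v ⊗ₜ v) ∈ lieOf f
      rw [tensorOp_tmul]
      exact rankOneOp_self_mem_lieOf halt v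
    · change tensorOp f (v ⊗ₜ w + w ⊗ₜ v) ∈ lieOf f
      rw [← sub_eq_add_of_charTwo F, map_sub, tensorOp_tmul, tensorOp_tmul, ← wedgeOp_eq]
      exact altSub_le_lieSub halt (wedgeOp_mem_altSub halt v w)
  · obtain ⟨c, hc⟩ := exists_sub_sum_rankOneOp_mem_altSub hb halt hx
    rw [← map_tensorOp_extSquare hb halt] at hc
    rw [← sub_add_cancel x (∑ k, c k • rankOneOp f (b k) (b k))]
    refine add_mem (LieSubmodule.map_mono hle hc) (sum_mem fun k _ => ?_)
    refine Submodule.smul_mem (LieSubmodule.toSubmodule _) _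
      ((LieSubmodule.mem_map _).2 ⟨b k ⊗ₜ b k, ?_, tensorOp_tmul _ _⟩)
    exact Submodule.subset_span (Or.inl ⟨_, rfl⟩)

/-- The form `f`, as a homomorphism `Λ²(V) → F` with `v ∧ w ↦ f v w`: the restriction of
`halfTrace` along `Λ²(V) ≅ L(f)^(1)`. -/
noncomputable def extSquareForm (hf : f.Nondegenerate) (hb : IsSymplecticBasis f b)
    (halt : f.IsAlt) :
    ↥(extSquare F (lieOf f) V) →ₗ⁅F, lieOf f⁆ TrivialLieModule F (lieOf f) F :=
  { (TrivialLieModule.equiv F (lieOf f) F).symm.toLinearMap ∘ₗ halfTrace f b ∘ₗ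
      (tensorOp f : (V ⊗[F] V) →ₗ[F] End F V) ∘ₗ (extSquare F (lieOf f) V).toSubmodule.subtype with
    map_lie' := by
      intro x t
      have ht : tensorOp f t ∈ altSub halt := by
        rw [← map_tensorOp_extSquare hb halt]
        exact (LieSubmodule.mem_map _).2 ⟨t, t.2, rfl⟩
      change (TrivialLieModule.equiv F (lieOf f) F).symm
        (halfTrace f b (tensorOp f ⁅x, (t : V ⊗[F] V)⁆)) = 0
      have h : tensorOp f ⁅x, (t : V ⊗[F] V)⁆ = ⁅(x : End F V), tensorOp f t⁆ :=
        (tensorOp f).map_lie x t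
      rw [h, halfTrace_eq_zero_of_mem_perpSpan hb halt
        (lie_mem_perpSpan hf x.2 (mem_span_wedgeOp hb halt ht)), map_zero] }

theorem equiv_extSquareForm (hf : f.Nondegenerate) (hb : IsSymplecticBasis f b) (halt : f.IsAlt)
    (t : ↥(extSquare F (lieOf f) V)) :
    TrivialLieModule.equiv F (lieOf f) F (extSquareForm hf hb halt t) =
      halfTrace f b (tensorOp f t) := rfl

theorem equiv_extSquareForm_wedge (hf : f.Nondegenerate) (hb : IsSymplecticBasis f b)
    (halt : f.IsAlt) (v w : V) :
    TrivialLieModule.equiv F (lieOf f) F (extSquareForm hf hb halt (wedge F (lieOf f) v w)) =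
      f v w := by
  rw [equiv_extSquareForm, wedge, map_sub, tensorOp_tmul, tensorOp_tmul, ← wedgeOp_eq,
    halfTrace_wedgeOp hb halt]

theorem extSquareForm_surjective (hf : f.Nondegenerate) (hb : IsSymplecticBasis f b)
    (halt : f.IsAlt) (hn : 0 < n) : Function.Surjective (extSquareForm hf hb halt) := by
  intro c
  refine ⟨wedge F (lieOf f) (TrivialLieModule.equiv F (lieOf f) F c • b (Sum.inl ⟨0, hn⟩))
    (b (Sum.inr ⟨0, hn⟩)), (TrivialLieModule.equiv F (lieOf f) F).injective ?_⟩
  rw [equiv_extSquareForm_wedge, map_smul, LinearMap.smul_apply, hb.apply]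
  simp

theorem nonempty_lieOf_equiv_symSquare (hb : IsSymplecticBasis f b) (halt : f.IsAlt) :
    Nonempty (↥(lieOf f) ≃ₗ⁅F, lieOf f⁆ ↥(symSquare F (lieOf f) V)) := by
  refine nonempty_lieModuleEquiv_of_range_eq (lieOf f).incl'
    ((tensorOp f).comp (symSquare F (lieOf f) V).incl) Subtype.val_injective
    ((tensorOp_injective hb).comp Subtype.val_injective) ?_
  ext x
  rw [LieModuleHom.mem_range, LieModuleHom.mem_range]
  have h := SetLike.ext_iff.1 (map_tensorOp_symSquare hb halt) x
  rw [mem_lieSub, LieSubmodule.mem_map] at h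
  constructor
  · rintro ⟨y, rfl⟩
    obtain ⟨t, ht, he⟩ := h.2 y.2
    exact ⟨⟨t, ht⟩, he⟩
  · rintro ⟨t, rfl⟩
    exact ⟨⟨_, h.1 ⟨t, t.2, rfl⟩⟩, rfl⟩

theorem nonempty_derivedIdeal_one_equiv_extSquare (hf : f.Nondegenerate)
    (hb : IsSymplecticBasis f b) (halt : f.IsAlt) :
    Nonempty (↥(derivedIdeal f 1) ≃ₗ⁅F, lieOf f⁆ ↥(extSquare F (lieOf f) V)) := by
  refine nonempty_lieModuleEquiv_of_range_eq
    ((lieOf f).incl'.comp (LieSubmodule.incl (derivedIdeal f 1)))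
    ((tensorOp f).comp (extSquare F (lieOf f) V).incl)
    (Subtype.val_injective.comp Subtype.val_injective)
    ((tensorOp_injective hb).comp Subtype.val_injective) ?_
  ext x
  rw [LieModuleHom.mem_range, LieModuleHom.mem_range]
  have h := SetLike.ext_iff.1 (map_tensorOp_extSquare hb halt) x
  rw [← derivedSub_one hf hb halt, mem_derivedSub, LieSubmodule.mem_map] at h
  constructor
  · rintro ⟨y, rfl⟩
    obtain ⟨t, ht, he⟩ := h.2 ⟨y, y.2, rfl⟩
    exact ⟨⟨t, ht⟩, he⟩
  · rintro ⟨t, rfl⟩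
    obtain ⟨y, hy, he⟩ := h.1 ⟨t, t.2, rfl⟩
    exact ⟨⟨y, hy⟩, he⟩

theorem nonempty_derivedIdeal_two_equiv_ker (hf : f.Nondegenerate)
    (hb : IsSymplecticBasis f b) (halt : f.IsAlt) (hn : 0 < n) :
    Nonempty (↥(derivedIdeal f 2) ≃ₗ⁅F, lieOf f⁆ ↥(extSquareForm hf hb halt).ker) := by
  refine nonempty_lieModuleEquiv_of_range_eq
    ((lieOf f).incl'.comp (LieSubmodule.incl (derivedIdeal f 2)))
    (((tensorOp f).comp (extSquare F (lieOf f) V).incl).comp (extSquareForm hf hb halt).ker.incl)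
    (Subtype.val_injective.comp Subtype.val_injective)
    (((tensorOp_injective hb).comp Subtype.val_injective).comp Subtype.val_injective) ?_
  have hker (t : ↥(extSquare F (lieOf f) V)) :
      t ∈ (extSquareForm hf hb halt).ker ↔ halfTrace f b (tensorOp f t) = 0 := by
    rw [LieModuleHom.mem_ker, ← equiv_extSquareForm hf hb halt, LinearEquiv.map_eq_zero_iff]
  ext x
  rw [LieModuleHom.mem_range, LieModuleHom.mem_range]
  have h := SetLike.ext_iff.1 (map_tensorOp_extSquare hb halt) x
  rw [LieSubmodule.mem_map] at h
  have h2 : x ∈ derivedSub f 2 ↔ x ∈ altSub halt ∧ halfTrace f b x = 0 := by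
    rw [derivedSub_two hf hb halt hn]
    exact mem_perpSpan_iff hf hb halt hn
  rw [mem_derivedSub] at h2
  constructor
  · rintro ⟨y, rfl⟩
    obtain ⟨h3, h4⟩ := h2.1 ⟨y, y.2, rfl⟩
    obtain ⟨t, ht, he⟩ := h.2 h3
    refine ⟨⟨⟨t, ht⟩, (hker _).2 ?_⟩, he⟩
    rw [← h4, ← he]
  · rintro ⟨t, rfl⟩
    obtain ⟨y, hy, he⟩ := h2.2 ⟨h.1 ⟨t.1, t.1.2, rfl⟩, (hker _).1 t.2⟩
    exact ⟨⟨y, hy⟩, he⟩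

end Tensor

/-! ### Dimensions and chains of subspaces -/

section Chains

variable {F M : Type*} [Field F] [AddCommGroup M] [Module F M] [FiniteDimensional F M]

theorem Submodule.finrank_inf_ker_add_finrank_map {M' : Type*} [AddCommGroup M'] [Module F M']
    (g : M →ₗ[F] M') (Q : Submodule F M) :
    finrank F ↥(Q ⊓ LinearMap.ker g) + finrank F (Q.map g) = finrank F Q := by
  have h := (g.domRestrict Q).finrank_range_add_finrank_ker
  rw [LinearMap.range_domRestrict, add_comm] at h
  rw [← h, ← Submodule.map_comap_subtype,
    ← LinearEquiv.finrank_eq (Submodule.equivMapOfInjective _ Q.injective_subtype _)]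
  rfl

theorem Submodule.covBy_of_finrank_eq_add_one {P Q : Submodule F M} (hPQ : P ≤ Q)
    (h : finrank F Q = finrank F P + 1) : P ⋖ Q := by
  refine ⟨lt_of_le_of_ne hPQ ?_, fun R hPR hRQ => ?_⟩
  · rintro rfl
    omega
  · have h1 := Submodule.finrank_lt_finrank_of_lt hPR
    have h2 := Submodule.finrank_lt_finrank_of_lt hRQ
    omega

theorem exists_isSubspaceChain (k : ℕ) (P Q : Submodule F M) (hPQ : P ≤ Q)
    (h : finrank F Q = finrank F P + k) : ∃ W : ℕ → Submodule F M, IsSubspaceChain P Q k W := by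
  induction k generalizing P with
  | zero =>
    have := Submodule.eq_of_le_of_finrank_eq hPQ h.symm
    exact ⟨fun _ => P, rfl, this, fun j hj => absurd hj (Nat.not_lt_zero j)⟩
  | succ k ih =>
    have hne : P ≠ Q := by
      rintro rfl
      omega
    obtain ⟨x, hxQ, hxP⟩ := SetLike.exists_of_lt (lt_of_le_of_ne hPQ hne)
    have hcov := Submodule.covBy_span_singleton_sup (K := F) hxP
    have hrank : finrank F ↥(Submodule.span F {x} ⊔ P) = finrank F P + 1 := by
      have h1 := Submodule.finrank_lt_finrank_of_lt hcov.lt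
      have h2 := Submodule.finrank_add_le_finrank_add_finrank (Submodule.span F {x}) P
      have h3 := finrank_span_singleton_le_one (F := F) x
      omega
    obtain ⟨W, hW0, hWk, hW⟩ := ih (Submodule.span F {x} ⊔ P)
      (sup_le ((Submodule.span_singleton_le_iff_mem _ _).2 hxQ) hPQ) (by omega)
    refine ⟨fun j => Nat.casesOn j P W, rfl, hWk, fun j hj => ?_⟩
    rcases j with _ | j
    · change P < W 0
      rw [hW0]
      exact hcov.lt
    · exact hW j (by omega)

omit [FiniteDimensional F M] in
theorem IsSubspaceChain.le_of_le {P Q : Submodule F M} {k : ℕ} {W : ℕ → Submodule F M}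
    (hW : IsSubspaceChain P Q k W) {i j : ℕ} (hij : i ≤ j) (hj : j ≤ k) : W i ≤ W j := by
  induction j, hij using Nat.le_induction with
  | base => exact le_rfl
  | succ j _ ih => exact (ih (by omega)).trans (hW.2.2 j (by omega)).le

/-- A chain as long as the dimension allows has steps of dimension one. -/
theorem IsSubspaceChain.covBy {P Q : Submodule F M} {k : ℕ} {W : ℕ → Submodule F M}
    (hW : IsSubspaceChain P Q k W) (h : finrank F Q = finrank F P + k) {j : ℕ} (hj : j < k) :
    W j ⋖ W (j + 1) := by
  have hstep : ∀ i < k, finrank F (W i) + 1 ≤ finrank F (W (i + 1)) := fun i hi =>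
    Submodule.finrank_lt_finrank_of_lt (hW.2.2 i hi)
  have hlow : ∀ i ≤ k, finrank F P + i ≤ finrank F (W i) := by
    intro i
    induction i with
    | zero => intro _; rw [hW.1]; omega
    | succ i ih =>
      intro hi
      have h1 := ih (by omega)
      have h2 := hstep i (by omega)
      omega
  have hhigh : ∀ i ≤ k, finrank F (W (k - i)) + i ≤ finrank F Q := by
    intro i
    induction i with
    | zero => intro _; rw [Nat.sub_zero, hW.2.1, add_zero]
    | succ i ih =>
      intro hi
      have h1 := ih (by omega)
      have h2 := hstep (k - (i + 1)) (by omega)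
      rw [show k - (i + 1) + 1 = k - i by omega] at h2
      omega
  refine Submodule.covBy_of_finrank_eq_add_one (hW.2.2 j hj).le ?_
  have h1 := hlow j hj.le
  have h2 := hhigh (k - (j + 1)) (by omega)
  rw [show k - (k - (j + 1)) = j + 1 by omega] at h2
  have h3 := hstep j hj
  omega

end Chains

theorem LieSubmodule.covBy_of_toSubmodule {F L M : Type*} [CommRing F] [LieRing L]
    [AddCommGroup M] [Module F M] [LieRingModule L M] {P Q : LieSubmodule F L M}
    (h : P.toSubmodule ⋖ Q.toSubmodule) : P ⋖ Q :=
  ⟨h.lt, fun R hPR hRQ => h.2 (c := R.toSubmodule) hPR hRQ⟩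

/-! ### Dimensions of the submodules of `gl(V)` -/

section Dimensions

variable {F V : Type*} [Field F] [AddCommGroup V] [Module F V] {f : LinearMap.BilinForm F V}

theorem mem_scalarSub {x : End F V} : x ∈ scalarSub f ↔ ∃ c : F, x = c • 1 := by
  change (∀ y : End F V, ⁅y, x⁆ = 0) ↔ _
  constructor
  · intro h
    have hx : x ∈ Subalgebra.center F (End F V) := by
      rw [Subalgebra.mem_center_iff]
      exact fun y => sub_eq_zero.1 (h y)
    rw [Algebra.IsCentral.center_eq_bot] at hx
    obtain ⟨c, rfl⟩ := Algebra.mem_bot.1 hx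
    exact ⟨c, Algebra.algebraMap_eq_smul_one c⟩
  · rintro ⟨c, rfl⟩ y
    rw [LieRing.of_associative_ring_bracket, mul_smul_comm, smul_mul_assoc, mul_one, one_mul,
      sub_self]

theorem scalarSub_toSubmodule : (scalarSub f).toSubmodule = Submodule.span F {(1 : End F V)} := by
  ext x
  rw [Submodule.mem_span_singleton]
  exact mem_scalarSub.trans ⟨fun ⟨c, h⟩ => ⟨c, h.symm⟩, fun ⟨c, h⟩ => ⟨c, h.symm⟩⟩

theorem mem_slSub {x : End F V} : x ∈ slSub f ↔ LinearMap.trace F V x = 0 := Iff.rfl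

theorem lie_scalarSub (y : lieOf f) {x : End F V} (hx : x ∈ scalarSub f) : ⁅y, x⁆ = 0 :=
  (show ∀ y : End F V, ⁅y, x⁆ = 0 from hx) y

/-- The diagonal of the Gram matrix of the form `f (x v) w`. -/
noncomputable def gramDiag {n : ℕ} (f : LinearMap.BilinForm F V)
    (b : Basis (Fin n ⊕ Fin n) F V) : End F V →ₗ[F] (Fin n ⊕ Fin n → F) where
  toFun x i := f (x (b i)) (b i)
  map_add' x y := by ext i; simp
  map_smul' c x := by ext i; simp

theorem gramDiag_apply {n : ℕ} (b : Basis (Fin n ⊕ Fin n) F V) (x : End F V) (i : Fin n ⊕ Fin n) :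
    gramDiag f b x i = f (x (b i)) (b i) := rfl

variable [CharP F 2] [FiniteDimensional F V] {n : ℕ} {b : Basis (Fin n ⊕ Fin n) F V}

omit [FiniteDimensional F V] in
theorem scalarSub_le_altSub (halt : f.IsAlt) : scalarSub f ≤ altSub halt := by
  intro x hx u
  obtain ⟨c, rfl⟩ := mem_scalarSub.1 hx
  simp [halt u]

omit [FiniteDimensional F V] in
theorem gramDiag_eq_zero_iff (halt : f.IsAlt) {x : End F V} (hx : x ∈ lieOf f) :
    gramDiag f b x = 0 ↔ x ∈ altSub halt := by
  rw [mem_altSub_iff_of_basis b halt]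
  exact ⟨fun h => ⟨hx, fun i => congrFun h i⟩, fun h => funext fun i => h.2 i⟩

omit [FiniteDimensional F V] in
theorem gramDiag_sum_rankOneOp (hb : IsSymplecticBasis f b) (c : Fin n ⊕ Fin n → F) :
    gramDiag f b (∑ k, c k • rankOneOp f (b k) (b k)) = fun i => c i.swap := by
  ext i
  simp only [gramDiag_apply, LinearMap.sum_apply, LinearMap.smul_apply, map_sum,
      map_smul, rankOneOp_apply, hb.apply, smul_eq_mul, mul_ite, mul_one, mul_zero]
  rw [Finset.sum_eq_single i.swap (fun k _ hk => ?_) (by simp)]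
  · simp
  · rw [if_neg]
    rintro rfl
    simp at hk

theorem finrank_lieSub (hb : IsSymplecticBasis f b) (halt : f.IsAlt) :
    finrank F (lieSub f).toSubmodule = finrank F (altSub halt).toSubmodule + 2 * n := by
  have h := Submodule.finrank_inf_ker_add_finrank_map (gramDiag f b) (lieSub f).toSubmodule
  have h1 : (lieSub f).toSubmodule ⊓ LinearMap.ker (gramDiag f b) =
      (altSub halt).toSubmodule := by
    ext x
    rw [Submodule.mem_inf, LinearMap.mem_ker]
    exact ⟨fun h => (gramDiag_eq_zero_iff halt h.1).1 h.2, fun h =>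
      ⟨altSub_le_lieSub halt h, (gramDiag_eq_zero_iff halt (altSub_le_lieSub halt h)).2 h⟩⟩
  have h2 : (lieSub f).toSubmodule.map (gramDiag f b) = ⊤ := by
    refine top_le_iff.1 fun c _ => ?_
    refine ⟨_, ?_, (gramDiag_sum_rankOneOp hb fun k => c k.swap).trans (by simp)⟩
    exact sum_mem fun k _ => (lieOf f).smul_mem _ (rankOneOp_self_mem_lieOf halt _)
  rw [h1, h2, finrank_top, finrank_fintype_fun_eq_card, Fintype.card_sum, Fintype.card_fin] at h
  omega

theorem finrank_altSub (hf : f.Nondegenerate) (hb : IsSymplecticBasis f b) (halt : f.IsAlt) :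
    finrank F (altSub halt).toSubmodule = (2 * n).choose 2 := by
  have h1 := Submodule.finrank_inf_ker_add_finrank_map
    (altPart hf : End F V →ₗ[F] End F V) ⊤
  have h2 : (⊤ : Submodule F (End F V)).map (altPart hf : End F V →ₗ[F] End F V) =
      (altSub halt).toSubmodule := by
    rw [← range_altPart hf hb halt, LieModuleHom.toSubmodule_range, Submodule.map_top]
  have h3 : (⊤ : Submodule F (End F V)) ⊓ LinearMap.ker (altPart hf : End F V →ₗ[F] End F V) =
      (lieSub f).toSubmodule := by
    ext x
    rw [top_inf_eq, LinearMap.mem_ker]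
    exact altPart_eq_zero_iff
  have hV : finrank F V = 2 * n := by
    rw [finrank_eq_card_basis b]
    simp
    omega
  rw [h2, h3, finrank_lieSub hb halt, finrank_top, finrank_linearMap, hV] at h1
  rw [Nat.choose_two_right]
  have h4 : 2 * n * (2 * n - 1) + 2 * n = 2 * n * (2 * n) := by
    rcases n with _ | n
    · rfl
    · rw [show 2 * (n + 1) - 1 = 2 * n + 1 by omega]
      ring
  omega

theorem finrank_perpSub (hf : f.Nondegenerate) (hb : IsSymplecticBasis f b) (halt : f.IsAlt)
    (hn : 0 < n) : finrank F (perpSub hf).toSubmodule + 1 = (2 * n).choose 2 := by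
  have h := Submodule.finrank_inf_ker_add_finrank_map (halfTrace f b) (altSub halt).toSubmodule
  have h1 : (altSub halt).toSubmodule ⊓ LinearMap.ker (halfTrace f b) =
      (perpSub hf).toSubmodule := by
    ext x
    exact (mem_perpSpan_iff hf hb halt hn).symm
  have h2 : (altSub halt).toSubmodule.map (halfTrace f b) = ⊤ := by
    refine top_le_iff.1 fun c _ => ⟨wedgeOp f (c • b (Sum.inl ⟨0, hn⟩)) (b (Sum.inr ⟨0, hn⟩)),
      wedgeOp_mem_altSub halt _ _, ?_⟩
    rw [halfTrace_wedgeOp hb halt, map_smul, LinearMap.smul_apply, hb.apply]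
    simp
  rwa [h1, h2, finrank_top, finrank_self, finrank_altSub hf hb halt] at h

theorem trace_rankOneOp (hf : f.Nondegenerate) (hb : IsSymplecticBasis f b) (halt : f.IsAlt)
    (v w : V) : LinearMap.trace F V (rankOneOp f v w) = f v w := by
  rw [← halfTrace_altPart hf hb halt, altPart_rankOneOp hf halt, halfTrace_wedgeOp hb halt]

theorem finrank_slSub (hf : f.Nondegenerate) (hb : IsSymplecticBasis f b) (halt : f.IsAlt)
    (hn : 0 < n) : finrank F (slSub f).toSubmodule + 1 = finrank F (End F V) := by
  have h := Submodule.finrank_inf_ker_add_finrank_map (LinearMap.trace F V) ⊤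
  have h2 : (⊤ : Submodule F (End F V)).map (LinearMap.trace F V) = ⊤ := by
    refine top_le_iff.1 fun c _ =>
      ⟨rankOneOp f (c • b (Sum.inl ⟨0, hn⟩)) (b (Sum.inr ⟨0, hn⟩)), trivial, ?_⟩
    rw [trace_rankOneOp hf hb halt, map_smul, LinearMap.smul_apply, hb.apply]
    simp
  rw [h2, top_inf_eq, finrank_top, finrank_top, finrank_self] at h
  exact h

omit [CharP F 2] [FiniteDimensional F V] in
theorem finrank_scalarSub [Nontrivial V] : finrank F (scalarSub f).toSubmodule = 1 := by
  rw [scalarSub_toSubmodule]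
  exact finrank_span_singleton one_ne_zero

end Dimensions

/-! ### Coverings in the lattice of submodules of `gl(V)` -/

section Coverings

variable {F V : Type*} [Field F] [AddCommGroup V] [Module F V] [CharP F 2] [FiniteDimensional F V]
  {f : LinearMap.BilinForm F V} {n : ℕ} {b : Basis (Fin n ⊕ Fin n) F V}

omit [CharP F 2] [FiniteDimensional F V] in
theorem IsSymplecticBasis.finrank_eq (_hb : IsSymplecticBasis f b) : finrank F V = 2 * n := by
  rw [finrank_eq_card_basis b, Fintype.card_sum, Fintype.card_fin]
  omega

theorem perpSub_le_lieSub (hf : f.Nondegenerate) (halt : f.IsAlt) : perpSub hf ≤ lieSub f :=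
  fun _ hx => altSub_le_lieSub halt (perpSpan_le_altSub halt hx)

/-- `perpSpan f` has dimension at least `5` if `dim V ≥ 4`. -/
theorem not_perpSpan_le_sup (hf : f.Nondegenerate) (hb : IsSymplecticBasis f b) (halt : f.IsAlt)
    (hn : 2 ≤ n) (x : End F V) :
    ¬ perpSpan f ≤ (scalarSub f).toSubmodule ⊔ Submodule.span F {x} := by
  intro h
  have h1 := finrank_perpSub hf hb halt (by omega)
  have h2 : finrank F (perpSpan f) ≤ _ := Submodule.finrank_mono h
  have h3 := Submodule.finrank_add_le_finrank_add_finrank (scalarSub f).toSubmodule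
    (Submodule.span F {x})
  have h4 := finrank_span_singleton_le_one (F := F) x
  have h5 : finrank F (scalarSub f).toSubmodule ≤ 1 := by
    rw [scalarSub_toSubmodule]
    exact finrank_span_singleton_le_one _
  have h6 : Nat.choose 4 2 ≤ (2 * n).choose 2 := Nat.choose_le_choose 2 (by omega)
  have h7 : Nat.choose 4 2 = 6 := rfl
  change finrank F (perpSpan f) + 1 = _ at h1
  omega

theorem exists_mem_perpSub_notMem_scalarSub (hf : f.Nondegenerate) (hb : IsSymplecticBasis f b)
    (halt : f.IsAlt) (hn : 2 ≤ n) : ∃ x ∈ perpSub hf, x ∉ scalarSub f := by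
  by_contra! hcon
  exact not_perpSpan_le_sup hf hb halt hn 0 fun x hx => Submodule.mem_sup_left (hcon x hx)

theorem perpSub_le_of_mem_of_notMem_scalarSub (hf : f.Nondegenerate) (hb : IsSymplecticBasis f b)
    (halt : f.IsAlt) (hn : 2 ≤ n) {K : LieSubmodule F (lieOf f) (End F V)} {x : End F V}
    (hxK : x ∈ K) (hx : x ∈ altSub halt) (hxs : x ∉ scalarSub f) : perpSub hf ≤ K :=
  perpSub_le_of_mem hf halt (by have := hb.finrank_eq; omega) hxK hx
    fun c hc => hxs (mem_scalarSub.2 ⟨c, hc⟩)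

theorem scalarSub_inf_perpSub_covBy (hf : f.Nondegenerate) (hb : IsSymplecticBasis f b)
    (halt : f.IsAlt) (hn : 2 ≤ n) : scalarSub f ⊓ perpSub hf ⋖ perpSub hf := by
  refine ⟨lt_of_le_of_ne inf_le_right fun h => ?_, fun R hPR hRQ => hRQ.not_ge ?_⟩
  · obtain ⟨x, hx, hxs⟩ := exists_mem_perpSub_notMem_scalarSub hf hb halt hn
    rw [← h] at hx
    exact hxs hx.1
  · obtain ⟨x, hxR, hx⟩ := SetLike.exists_of_lt hPR
    have hxp := hRQ.le hxR
    exact perpSub_le_of_mem_of_notMem_scalarSub hf hb halt hn hxR (perpSpan_le_altSub halt hxp)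
      fun hs => hx ⟨hs, hxp⟩

/-- The counterpart in `sl(V)` of `scalarSub_inf_perpSub_covBy`, along the map `x ↦ x - x*`, whose
kernel is `L(f)`. -/
theorem comap_altPart_inf_slSub_covBy (hf : f.Nondegenerate) (hb : IsSymplecticBasis f b)
    (halt : f.IsAlt) (hn : 2 ≤ n) :
    LieSubmodule.comap (altPart hf) (scalarSub f) ⊓ slSub f ⋖ slSub f := by
  have hsl (x : End F V) : x ∈ slSub f ↔ altPart hf x ∈ perpSub hf := by
    rw [mem_perpSub, mem_perpSpan_iff hf hb halt (by omega), halfTrace_altPart hf hb halt,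
      mem_slSub]
    exact ⟨fun h => ⟨altPart_mem_altSub hf halt x, h⟩, fun h => h.2⟩
  have hrange {y : End F V} (hy : y ∈ perpSub hf) : ∃ x, altPart hf x = y := by
    rw [← LieModuleHom.mem_range, range_altPart hf hb halt]
    exact perpSpan_le_altSub halt hy
  refine ⟨lt_of_le_of_ne inf_le_right fun h => ?_, fun R hPR hRQ => hRQ.not_ge fun z hz => ?_⟩
  · obtain ⟨y, hy, hys⟩ := exists_mem_perpSub_notMem_scalarSub hf hb halt hn
    obtain ⟨x, rfl⟩ := hrange hy
    have hx := (hsl x).2 hy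
    rw [← h] at hx
    exact hys hx.1
  · obtain ⟨x, hxR, hx⟩ := SetLike.exists_of_lt hPR
    have hle : perpSub hf ≤ LieSubmodule.map (altPart hf) R :=
      perpSub_le_of_mem_of_notMem_scalarSub hf hb halt hn (LieSubmodule.mem_map_of_mem hxR)
        (altPart_mem_altSub hf halt x) fun hs => hx ⟨hs, hRQ.le hxR⟩
    obtain ⟨r, hr, he⟩ := (LieSubmodule.mem_map _).1 (hle ((hsl z).1 hz))
    have h0 : altPart hf (z - r) = 0 := by rw [map_sub, he, sub_self]
    rw [← sub_add_cancel z r]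
    refine add_mem (hPR.le ⟨?_, sub_mem hz (hRQ.le hr)⟩) hr
    change altPart hf (z - r) ∈ scalarSub f
    rw [h0]
    exact zero_mem _

theorem exists_lie_notMem_scalarSub (hf : f.Nondegenerate) (hb : IsSymplecticBasis f b)
    (halt : f.IsAlt) (hn : 2 ≤ n) :
    ∃ y : lieOf f, ∃ x ∈ perpSub hf, ⁅y, x⁆ ∉ scalarSub f := by
  by_contra! hcon
  obtain ⟨x, hx, hxs⟩ := exists_mem_perpSub_notMem_scalarSub hf hb halt hn
  -- Then the scalars and `x` span a submodule, which is too small.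
  let K : LieSubmodule F (lieOf f) (End F V) :=
    { (scalarSub f).toSubmodule ⊔ Submodule.span F {x} with
      lie_mem := by
        intro y z hz
        obtain ⟨s, hs, t, ht, rfl⟩ := Submodule.mem_sup.1 hz
        obtain ⟨c, rfl⟩ := Submodule.mem_span_singleton.1 ht
        refine Submodule.mem_sup_left ?_
        rw [lie_add, lie_scalarSub y hs, zero_add, lie_smul]
        exact Submodule.smul_mem _ c (hcon y x hx) }
  exact not_perpSpan_le_sup hf hb halt hn x (perpSub_le_of_mem_of_notMem_scalarSub hf hb halt hn
    (K := K) (Submodule.mem_sup_right (Submodule.mem_span_singleton_self x))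
    (perpSpan_le_altSub halt hx) hxs)

theorem exists_perpSub_lie_notMem_scalarSub (hf : f.Nondegenerate) (hb : IsSymplecticBasis f b)
    (halt : f.IsAlt) (hn : 3 ≤ n) :
    ∃ y ∈ perpSub hf, ∃ x ∈ perpSub hf, ⁅y, x⁆ ∉ scalarSub f := by
  by_contra! hcon
  obtain ⟨x, hx, hxs⟩ := exists_mem_perpSub_notMem_scalarSub hf hb halt (by omega)
  refine not_perpSpan_le_sup hf hb halt (by omega) x (perpSpan_le_of_mem hf halt
    (by have := hb.finrank_eq; omega) (fun y hy z hz => ?_)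
    (Submodule.mem_sup_right (Submodule.mem_span_singleton_self x))
    (perpSpan_le_altSub halt hx) fun c hc => hxs (mem_scalarSub.2 ⟨c, hc⟩))
  obtain ⟨s, hs, t, ht, rfl⟩ := Submodule.mem_sup.1 hz
  obtain ⟨c, rfl⟩ := Submodule.mem_span_singleton.1 ht
  refine Submodule.mem_sup_left ?_
  have h0 : ⁅y, s⁆ = 0 := lie_scalarSub (f := f) ⟨y, perpSub_le_lieSub hf halt hy⟩ hs
  rw [lie_add, h0, zero_add, lie_smul]
  exact Submodule.smul_mem _ c (hcon y hy x hx)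

theorem scalarSub_le_perpSub (hf : f.Nondegenerate) (hb : IsSymplecticBasis f b) (halt : f.IsAlt)
    (hn : 0 < n) (h2 : Even n) : scalarSub f ≤ perpSub hf := by
  intro x hx
  rw [mem_perpSub, mem_perpSpan_iff hf hb halt hn]
  refine ⟨scalarSub_le_altSub halt hx, ?_⟩
  obtain ⟨c, rfl⟩ := mem_scalarSub.1 hx
  rw [map_smul, halfTrace_one hb, (CharP.cast_eq_zero_iff F 2 n).2 h2.two_dvd, smul_zero]

theorem eq_zero_of_mem_scalarSub_of_mem_perpSub (hf : f.Nondegenerate)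
    (hb : IsSymplecticBasis f b) (halt : f.IsAlt) (h2 : ¬ Even n) {x : End F V}
    (hx : x ∈ scalarSub f) (hx' : x ∈ perpSub hf) : x = 0 := by
  obtain ⟨c, rfl⟩ := mem_scalarSub.1 hx
  have h := halfTrace_eq_zero_of_mem_perpSpan hb halt hx'
  rw [map_smul, halfTrace_one hb, smul_eq_mul, mul_eq_zero] at h
  rcases h with rfl | h
  · rw [zero_smul]
  · exact absurd (even_iff_two_dvd.2 ((CharP.cast_eq_zero_iff F 2 n).1 h)) h2

theorem comap_altPart_scalarSub_toSubmodule (hf : f.Nondegenerate)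
    (hb : IsSymplecticBasis f b) :
    (LieSubmodule.comap (altPart hf) (scalarSub f)).toSubmodule =
      (lieSub f).toSubmodule ⊔ Submodule.span F {halfIdentity b} := by
  apply le_antisymm
  · intro x hx
    obtain ⟨c, hc⟩ := mem_scalarSub.1 (show altPart hf x ∈ scalarSub f from hx)
    rw [← sub_add_cancel x (c • halfIdentity b)]
    refine Submodule.add_mem_sup (altPart_eq_zero_iff (hf := hf).1 ?_)
      (Submodule.smul_mem _ c (Submodule.mem_span_singleton_self _))
    rw [map_sub, map_smul, altPart_halfIdentity hf hb, hc, sub_self]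
  · refine sup_le (fun x hx => ?_) ((Submodule.span_singleton_le_iff_mem _ _).2 ?_)
    · change altPart hf x ∈ scalarSub f
      rw [altPart_eq_zero_iff.2 hx]
      exact zero_mem _
    · change altPart hf (halfIdentity b) ∈ scalarSub f
      rw [altPart_halfIdentity hf hb]
      exact mem_scalarSub.2 ⟨1, (one_smul F 1).symm⟩

theorem halfIdentity_notMem_lieOf [Nontrivial V] (hf : f.Nondegenerate)
    (hb : IsSymplecticBasis f b) : halfIdentity b ∉ lieOf f := by
  rw [← altPart_eq_zero_iff (hf := hf), altPart_halfIdentity hf hb]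
  exact one_ne_zero

theorem lieSub_covBy_comap_altPart [Nontrivial V] (hf : f.Nondegenerate)
    (hb : IsSymplecticBasis f b) :
    lieSub f ⋖ LieSubmodule.comap (altPart hf) (scalarSub f) := by
  refine LieSubmodule.covBy_of_toSubmodule ?_
  rw [comap_altPart_scalarSub_toSubmodule hf hb, sup_comm]
  exact Submodule.covBy_span_singleton_sup (halfIdentity_notMem_lieOf hf hb)

theorem comap_altPart_scalarSub_le_slSub (hf : f.Nondegenerate) (hb : IsSymplecticBasis f b)
    (halt : f.IsAlt) (hn : 0 < n) (h2 : Even n) :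
    LieSubmodule.comap (altPart hf) (scalarSub f) ≤ slSub f := by
  intro x hx
  rw [mem_slSub, ← halfTrace_altPart hf hb halt]
  exact halfTrace_eq_zero_of_mem_perpSpan hb halt (scalarSub_le_perpSub hf hb halt hn h2 hx)

theorem lieSub_le_slSub (hf : f.Nondegenerate) (hb : IsSymplecticBasis f b) (halt : f.IsAlt) :
    lieSub f ≤ slSub f := by
  intro x hx
  rw [mem_slSub, ← halfTrace_altPart hf hb halt, altPart_eq_zero_iff.2 hx, map_zero]

theorem comap_altPart_inf_slSub_eq_lieSub (hf : f.Nondegenerate) (hb : IsSymplecticBasis f b)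
    (halt : f.IsAlt) (hn : 0 < n) (h2 : ¬ Even n) :
    LieSubmodule.comap (altPart hf) (scalarSub f) ⊓ slSub f = lieSub f := by
  refine le_antisymm (fun x hx => ?_) (le_inf (fun x hx => ?_) (lieSub_le_slSub hf hb halt))
  · refine altPart_eq_zero_iff (hf := hf).1
      (eq_zero_of_mem_scalarSub_of_mem_perpSub hf hb halt h2 hx.1 ?_)
    rw [mem_perpSub, mem_perpSpan_iff hf hb halt hn, halfTrace_altPart hf hb halt]
    exact ⟨altPart_mem_altSub hf halt x, hx.2⟩
  · change altPart hf x ∈ scalarSub f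
    rw [altPart_eq_zero_iff.2 hx]
    exact zero_mem _

theorem derivedSub_two_covBy_derivedSub_one (hf : f.Nondegenerate) (hb : IsSymplecticBasis f b)
    (halt : f.IsAlt) (hn : 0 < n) : derivedSub f 2 ⋖ derivedSub f 1 := by
  rw [derivedSub_one hf hb halt, derivedSub_two hf hb halt hn]
  refine LieSubmodule.covBy_of_toSubmodule (Submodule.covBy_of_finrank_eq_add_one
    (perpSpan_le_altSub halt) ?_)
  rw [finrank_perpSub hf hb halt hn, finrank_altSub hf hb halt]

theorem slSub_covBy_top (hf : f.Nondegenerate) (hb : IsSymplecticBasis f b)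
    (halt : f.IsAlt) (hn : 0 < n) : slSub f ⋖ ⊤ := by
  refine LieSubmodule.covBy_of_toSubmodule (Submodule.covBy_of_finrank_eq_add_one le_top ?_)
  rw [finrank_slSub hf hb halt hn, LieSubmodule.top_toSubmodule, finrank_top]

omit [CharP F 2] in
theorem bot_covBy_scalarSub [Nontrivial V] : ⊥ ⋖ scalarSub f := by
  refine LieSubmodule.covBy_of_toSubmodule (Submodule.covBy_of_finrank_eq_add_one bot_le ?_)
  rw [finrank_scalarSub, LieSubmodule.bot_toSubmodule, finrank_bot]

/-- All subspaces between `L(f)^(1)` and `L(f)` are `L(f)`-submodules, so that maximal chains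
between these two consist of submodules, with trivial factors. -/
theorem exists_lieSubmodule_chain (hf : f.Nondegenerate) (hb : IsSymplecticBasis f b)
    (halt : f.IsAlt) {W : ℕ → Submodule F (End F V)}
    (hW : IsSubspaceChain (derivedSub f 1).toSubmodule (lieSub f).toSubmodule (2 * n) W) :
    ∃ X : ℕ → LieSubmodule F (lieOf f) (End F V), (∀ j ≤ 2 * n, (X j).toSubmodule = W j) ∧
      X 0 = derivedSub f 1 ∧ X (2 * n) = lieSub f ∧ ∀ j < 2 * n, X j ⋖ X (j + 1) ∧
        LieModule.IsTrivial (lieOf f) (lieFactor (X j) (X (j + 1))) := by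
  have hlie (j : ℕ) (hj : j ≤ 2 * n) (y : lieOf f) {x : End F V} (hx : x ∈ lieSub f) :
      ⁅y, x⁆ ∈ W j := by
    refine hW.le_of_le (Nat.zero_le j) hj ?_
    rw [hW.1, derivedSub_one hf hb halt]
    exact lie_mem_altSub halt y.2 hx
  have hle (j : ℕ) (hj : j ≤ 2 * n) : W j ≤ (lieSub f).toSubmodule :=
    (hW.le_of_le hj le_rfl).trans hW.2.1.le
  have hex : ∀ j, ∃ X : LieSubmodule F (lieOf f) (End F V), j ≤ 2 * n → X.toSubmodule = W j := by
    intro j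
    by_cases hj : j ≤ 2 * n
    · exact ⟨{ W j with lie_mem := fun {y x} hx => hlie j hj y (hle j hj hx) }, fun _ => rfl⟩
    · exact ⟨⊥, fun h => absurd h hj⟩
  choose X hX using hex
  refine ⟨X, hX, ?_, ?_, fun j hj => ⟨?_, ?_⟩⟩
  · rw [← LieSubmodule.toSubmodule_inj, hX 0 (Nat.zero_le _), hW.1]
  · rw [← LieSubmodule.toSubmodule_inj, hX _ le_rfl, hW.2.1]
  · refine LieSubmodule.covBy_of_toSubmodule ?_
    rw [hX j hj.le, hX (j + 1) hj]
    refine hW.covBy ?_ hj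
    rw [finrank_lieSub hb halt, derivedSub_one hf hb halt]
  · refine lieFactor_isTrivial_iff.2 fun y x hx => ?_
    rw [← LieSubmodule.mem_toSubmodule, hX (j + 1) hj] at hx
    rw [← LieSubmodule.mem_toSubmodule, hX j hj.le]
    exact hlie j hj.le y (hle (j + 1) hj hx)

end Coverings

/-! ### Matrices relative to a symplectic basis -/

section Matrices

variable {F V : Type*} [Field F] [AddCommGroup V] [Module F V] [CharP F 2]
  {f : LinearMap.BilinForm F V} {n : ℕ} {b : Basis (Fin n ⊕ Fin n) F V}

theorem IsSymplecticBasis.toMatrix_apply (hb : IsSymplecticBasis f b) (x : End F V)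
    (i j : Fin n ⊕ Fin n) : LinearMap.toMatrix b b x i j = f (x (b j)) (b i.swap) := by
  rw [LinearMap.toMatrix_apply, hb.repr_apply]

theorem mem_lieOf_iff_exists_fromBlocks (hb : IsSymplecticBasis f b) (halt : f.IsAlt)
    (x : End F V) : x ∈ lieOf f ↔
      ∃ A B C : Matrix (Fin n) (Fin n) F, B.IsSymm ∧ C.IsSymm ∧
        LinearMap.toMatrix b b x = Matrix.fromBlocks A B C A.transpose := by
  rw [mem_lieOf_iff_of_basis b halt]
  constructor
  · intro h
    refine ⟨(LinearMap.toMatrix b b x).toBlocks₁₁, (LinearMap.toMatrix b b x).toBlocks₁₂,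
      (LinearMap.toMatrix b b x).toBlocks₂₁, ?_, ?_, ?_⟩
    · ext i j
      simp [Matrix.toBlocks₁₂, hb.toMatrix_apply, h (Sum.inr j)]
    · ext i j
      simp [Matrix.toBlocks₂₁, hb.toMatrix_apply, h (Sum.inl j)]
    · conv_lhs => rw [← Matrix.fromBlocks_toBlocks (LinearMap.toMatrix b b x)]
      congr 1
      ext i j
      simp [Matrix.toBlocks₂₂, Matrix.toBlocks₁₁, hb.toMatrix_apply, h (Sum.inr j)]
  · rintro ⟨A, B, C, hB, hC, h⟩ i j
    have h' (i j : Fin n ⊕ Fin n) :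
        f (x (b i)) (b j) = Matrix.fromBlocks A B C A.transpose j.swap i := by
      rw [← h, hb.toMatrix_apply, Sum.swap_swap]
    rw [h', h']
    rcases i with i | i <;> rcases j with j | j
    · exact hC.apply i j
    · rfl
    · rfl
    · exact hB.apply i j

theorem mem_altSub_iff_exists_fromBlocks (hb : IsSymplecticBasis f b) (halt : f.IsAlt)
    (x : End F V) : x ∈ altSub halt ↔
      ∃ A B C : Matrix (Fin n) (Fin n) F, IsAlternatingMatrix B ∧ IsAlternatingMatrix C ∧
        LinearMap.toMatrix b b x = Matrix.fromBlocks A B C A.transpose := by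
  rw [mem_altSub_iff_of_basis b halt, mem_lieOf_iff_exists_fromBlocks hb halt]
  have hdiag (i : Fin n ⊕ Fin n) : f (x (b i)) (b i) = LinearMap.toMatrix b b x i.swap i := by
    rw [hb.toMatrix_apply, Sum.swap_swap]
  constructor
  · rintro ⟨⟨A, B, C, hB, hC, h⟩, h0⟩
    refine ⟨A, B, C, ⟨fun i j => ?_, fun i => ?_⟩, ⟨fun i j => ?_, fun i => ?_⟩, h⟩
    · rw [CharTwo.neg_eq, hB.apply]
    · have h1 := h0 (Sum.inr i)
      rwa [hdiag, h] at h1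
    · rw [CharTwo.neg_eq, hC.apply]
    · have h1 := h0 (Sum.inl i)
      rwa [hdiag, h] at h1
  · rintro ⟨A, B, C, hB, hC, h⟩
    refine ⟨⟨A, B, C, ?_, ?_, h⟩, ?_⟩
    · ext i j
      rw [Matrix.transpose_apply, hB.1, CharTwo.neg_eq]
    · ext i j
      rw [Matrix.transpose_apply, hC.1, CharTwo.neg_eq]
    · rintro (i | i)
      · rw [hdiag, h]
        exact hC.2 i
      · rw [hdiag, h]
        exact hB.2 i

theorem mem_perpSpan_iff_exists_fromBlocks [FiniteDimensional F V] (hf : f.Nondegenerate)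
    (hb : IsSymplecticBasis f b) (halt : f.IsAlt) (hn : 0 < n)
    (x : End F V) : x ∈ perpSpan f ↔
      ∃ A B C : Matrix (Fin n) (Fin n) F, IsAlternatingMatrix B ∧ IsAlternatingMatrix C ∧
        A.trace = 0 ∧ LinearMap.toMatrix b b x = Matrix.fromBlocks A B C A.transpose := by
  have htr {A B C D : Matrix (Fin n) (Fin n) F}
      (h : LinearMap.toMatrix b b x = Matrix.fromBlocks A B C D) : halfTrace f b x = A.trace := by
    rw [halfTrace_apply, Matrix.trace]
    refine Finset.sum_congr rfl fun i _ => ?_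
    rw [Matrix.diag_apply, ← Matrix.fromBlocks_apply₁₁ A B C D, ← h, hb.toMatrix_apply]
    rfl
  rw [mem_perpSpan_iff hf hb halt hn, mem_altSub_iff_exists_fromBlocks hb halt]
  constructor
  · rintro ⟨⟨A, B, C, hB, hC, h⟩, h0⟩
    exact ⟨A, B, C, hB, hC, (htr h).symm.trans h0, h⟩
  · rintro ⟨A, B, C, hB, hC, h0, h⟩
    exact ⟨⟨A, B, C, hB, hC, h⟩, (htr h).trans h0⟩

/-- In dimension `4`, the operators in `perpSpan f` have scalar squares, hence commute modulo
scalars; the latter is verified on matrices. -/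
theorem lie_mem_scalarSub_of_mem_perpSpan [FiniteDimensional F V] (hf : f.Nondegenerate)
    {b : Basis (Fin 2 ⊕ Fin 2) F V} (hb : IsSymplecticBasis f b) (halt : f.IsAlt)
    {x y : End F V} (hx : x ∈ perpSpan f) (hy : y ∈ perpSpan f) : ⁅x, y⁆ ∈ scalarSub f := by
  obtain ⟨A, B, C, hB, hC, hA, h⟩ :=
    (mem_perpSpan_iff_exists_fromBlocks hf hb halt two_pos x).1 hx
  obtain ⟨A', B', C', hB', hC', hA', h'⟩ :=
    (mem_perpSpan_iff_exists_fromBlocks hf hb halt two_pos y).1 hy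
  have h2 : (2 : F) = 0 := CharTwo.two_eq_zero
  rw [Matrix.trace_fin_two] at hA hA'
  have hB0 := hB.2 0
  have hB1 := hB.2 1
  have hB01 := hB.1 0 1
  have hC0 := hC.2 0
  have hC1 := hC.2 1
  have hC01 := hC.1 0 1
  have hB0' := hB'.2 0
  have hB1' := hB'.2 1
  have hB01' := hB'.1 0 1
  have hC0' := hC'.2 0
  have hC1' := hC'.2 1
  have hC01' := hC'.1 0 1
  let c : F := A 0 1 * A' 1 0 + A 1 0 * A' 0 1 + B 0 1 * C' 0 1 + C 0 1 * B' 0 1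
  refine mem_scalarSub.2 ⟨c, (LinearMap.toMatrix b b).injective ?_⟩
  rw [map_smul, LinearMap.toMatrix_one, LieRing.of_associative_ring_bracket, map_sub,
    LinearMap.toMatrix_mul, LinearMap.toMatrix_mul, h, h', Matrix.fromBlocks_multiply,
    Matrix.fromBlocks_multiply]
  ext i j
  rcases i with i | i <;> rcases j with j | j <;> fin_cases i <;> fin_cases j <;>
    simp [Matrix.mul_apply, Fin.sum_univ_two, c] <;> grind

end Matrices

/-! ### Simplicity of `L(f)^(2)` modulo scalars -/

section Simple

variable {F V : Type*} [Field F] [AddCommGroup V] [Module F V] [CharP F 2] [FiniteDimensional F V]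
  {f : LinearMap.BilinForm F V} {n : ℕ} {b : Basis (Fin n ⊕ Fin n) F V}

omit [CharP F 2] [FiniteDimensional F V] in
theorem mem_scalarIdeal {x : ↥(derivedIdeal f 2)} :
    x ∈ scalarIdeal f ↔ ((x : lieOf f) : End F V) ∈ scalarSub f := by
  rw [scalarIdeal, LieIdeal.mem_comap]
  rfl

theorem coe_mem_perpSub (hf : f.Nondegenerate) (hb : IsSymplecticBasis f b) (halt : f.IsAlt)
    (hn : 0 < n) (x : ↥(derivedIdeal f 2)) : ((x : lieOf f) : End F V) ∈ perpSub hf := by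
  rw [← derivedSub_two hf hb halt hn]
  exact coe_mem_derivedSub.2 x.2

theorem exists_coe_eq_of_mem_perpSub (hf : f.Nondegenerate) (hb : IsSymplecticBasis f b)
    (halt : f.IsAlt) (hn : 0 < n) {x : End F V} (hx : x ∈ perpSub hf) :
    ∃ y : ↥(derivedIdeal f 2), ((y : lieOf f) : End F V) = x := by
  rw [← derivedSub_two hf hb halt hn] at hx
  obtain ⟨y, hy, he⟩ := mem_derivedSub.1 hx
  exact ⟨⟨y, hy⟩, he⟩

/-- An ideal of `L(f)^(2)` either consists of scalars or is everything, if `dim V > 4`. -/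
theorem forall_mem_scalarIdeal_or_eq_top (hf : f.Nondegenerate) (hb : IsSymplecticBasis f b)
    (halt : f.IsAlt) (hn : 3 ≤ n) (I : Submodule F ↥(derivedIdeal f 2))
    (hI : ∀ y : ↥(derivedIdeal f 2), ∀ x ∈ I, ⁅y, x⁆ ∈ I) :
    (∀ x ∈ I, x ∈ scalarIdeal f) ∨ I = ⊤ := by
  by_contra! hcon
  obtain ⟨⟨x, hx, hxs⟩, hne⟩ := hcon
  refine hne (top_le_iff.1 fun z _ => ?_)
  let i : ↥(derivedIdeal f 2) →ₗ[F] End F V :=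
    (lieOf f).toSubmodule.subtype ∘ₗ (derivedIdeal f 2).toSubmodule.subtype
  have hle : perpSpan f ≤ I.map i := by
    refine perpSpan_le_of_mem hf halt (by have := hb.finrank_eq; omega) ?_
      (Submodule.mem_map_of_mem hx)
      (perpSpan_le_altSub halt (coe_mem_perpSub hf hb halt (by omega) x))
      fun c hc => hxs (mem_scalarIdeal.2 (mem_scalarSub.2 ⟨c, hc⟩))
    rintro y hy _ ⟨w, hw, rfl⟩
    obtain ⟨y, rfl⟩ := exists_coe_eq_of_mem_perpSub hf hb halt (by omega) hy
    exact ⟨⁅y, w⁆, hI y w hw, rfl⟩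
  obtain ⟨w, hw, he⟩ := hle (coe_mem_perpSub hf hb halt (by omega) z)
  rwa [Subtype.ext (Subtype.ext he : (w : lieOf f) = z)] at hw

theorem isSimple_quotient_scalarIdeal (hf : f.Nondegenerate) (hb : IsSymplecticBasis f b)
    (halt : f.IsAlt) (hn : 3 ≤ n) :
    LieAlgebra.IsSimple F (↥(derivedIdeal f 2) ⧸ scalarIdeal f) where
  eq_bot_or_eq_top J := by
    let I : Submodule F ↥(derivedIdeal f 2) :=
      J.toSubmodule.comap (scalarIdeal f).toSubmodule.mkQ
    have hI (y x : ↥(derivedIdeal f 2)) (hx : x ∈ I) : ⁅y, x⁆ ∈ I :=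
      J.lie_mem (x := LieSubmodule.Quotient.mk y) hx
    rcases forall_mem_scalarIdeal_or_eq_top hf hb halt hn I hI with h | h
    · left
      refine le_bot_iff.1 fun t ht => ?_
      obtain ⟨x, rfl⟩ := LieSubmodule.Quotient.surjective_mk' _ t
      rw [LieSubmodule.mem_bot, LieSubmodule.Quotient.mk_eq_zero]
      exact h x ht
    · right
      refine top_le_iff.1 fun t _ => ?_
      obtain ⟨x, rfl⟩ := LieSubmodule.Quotient.surjective_mk' _ t
      exact (show x ∈ I by rw [h]; trivial)
  non_abelian hab := by
    obtain ⟨y, hy, x, hx, h⟩ := exists_perpSub_lie_notMem_scalarSub hf hb halt hn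
    obtain ⟨y, rfl⟩ := exists_coe_eq_of_mem_perpSub hf hb halt (by omega) hy
    obtain ⟨x, rfl⟩ := exists_coe_eq_of_mem_perpSub hf hb halt (by omega) hx
    refine h (mem_scalarIdeal (x := ⁅y, x⁆).1 ?_)
    have h1 := hab.trivial (LieSubmodule.Quotient.mk y) (LieSubmodule.Quotient.mk x)
    rw [← LieSubmodule.Quotient.mk_bracket] at h1
    exact LieSubmodule.Quotient.mk_eq_zero'.1 h1

theorem isSimple_derivedIdeal_two (hf : f.Nondegenerate) (hb : IsSymplecticBasis f b)
    (halt : f.IsAlt) (hn : 3 ≤ n) (h2 : ¬ Even n) :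
    LieAlgebra.IsSimple F ↥(derivedIdeal f 2) where
  eq_bot_or_eq_top J := by
    rcases forall_mem_scalarIdeal_or_eq_top hf hb halt hn J.toSubmodule
      (fun y x hx => J.lie_mem hx) with h | h
    · left
      refine le_bot_iff.1 fun x hx => ?_
      rw [LieSubmodule.mem_bot]
      exact Subtype.ext (Subtype.ext (eq_zero_of_mem_scalarSub_of_mem_perpSub hf hb halt h2
        (mem_scalarIdeal.1 (h x hx)) (coe_mem_perpSub hf hb halt (by omega) x)))
    · right
      exact (LieSubmodule.toSubmodule_inj _ _).1 h
  non_abelian hab := by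
    obtain ⟨y, hy, x, hx, h⟩ := exists_perpSub_lie_notMem_scalarSub hf hb halt hn
    obtain ⟨y, rfl⟩ := exists_coe_eq_of_mem_perpSub hf hb halt (by omega) hy
    obtain ⟨x, rfl⟩ := exists_coe_eq_of_mem_perpSub hf hb halt (by omega) hx
    refine h (mem_scalarIdeal (x := ⁅y, x⁆).1 ?_)
    rw [hab.trivial y x]
    exact zero_mem _

theorem not_isSimple_quotient_scalarIdeal (hf : f.Nondegenerate)
    {b : Basis (Fin 2 ⊕ Fin 2) F V} (hb : IsSymplecticBasis f b) (halt : f.IsAlt) :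
    ¬ LieAlgebra.IsSimple F (↥(derivedIdeal f 2) ⧸ scalarIdeal f) := by
  intro h
  refine h.non_abelian ⟨fun s t => ?_⟩
  obtain ⟨x, rfl⟩ := LieSubmodule.Quotient.surjective_mk' _ s
  obtain ⟨y, rfl⟩ := LieSubmodule.Quotient.surjective_mk' _ t
  change (LieSubmodule.Quotient.mk ⁅x, y⁆ : ↥(derivedIdeal f 2) ⧸ scalarIdeal f) = 0
  refine LieSubmodule.Quotient.mk_eq_zero'.2 (mem_scalarIdeal.2 ?_)
  exact lie_mem_scalarSub_of_mem_perpSpan hf hb halt (coe_mem_perpSub hf hb halt two_pos x)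
    (coe_mem_perpSub hf hb halt two_pos y)

end Simple

/-! ### The Heisenberg quotient -/

section Heisenberg

variable {F V : Type*} [Field F] [AddCommGroup V] [Module F V] [CharP F 2] [FiniteDimensional F V]
  {f : LinearMap.BilinForm F V} {n : ℕ} {b : Basis (Fin n ⊕ Fin n) F V}

/-- Modulo alternating operators, which do not contribute, `x` and `y` are combinations of the
operators `u ↦ f (b k) u • b k`, and the bracket of two of these is a multiple of a `wedgeOp`. -/
theorem halfTrace_lie (hf : f.Nondegenerate) (hb : IsSymplecticBasis f b) (halt : f.IsAlt)
    {x y : End F V} (hx : x ∈ lieOf f) (hy : y ∈ lieOf f) :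
    halfTrace f b ⁅x, y⁆ = ∑ k, gramDiag f b x k * gramDiag f b y k.swap := by
  have hzero {u v : End F V} (hu : u ∈ lieOf f) (hv : v ∈ altSub halt) :
      halfTrace f b ⁅u, v⁆ = 0 :=
    halfTrace_eq_zero_of_mem_perpSpan hb halt
      (lie_mem_perpSpan hf hu (mem_span_wedgeOp hb halt hv))
  obtain ⟨c, hc⟩ := exists_sub_sum_rankOneOp_mem_altSub hb halt hx
  obtain ⟨d, hd⟩ := exists_sub_sum_rankOneOp_mem_altSub hb halt hy
  set x' : End F V := ∑ k, c k • rankOneOp f (b k) (b k) with hx'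
  set y' : End F V := ∑ k, d k • rankOneOp f (b k) (b k) with hy'
  have hxL : x' ∈ lieOf f :=
    sum_mem fun k _ => (lieOf f).smul_mem _ (rankOneOp_self_mem_lieOf halt _)
  have hgx : gramDiag f b x = fun k => c k.swap := by
    rw [← gramDiag_sum_rankOneOp hb c, ← hx', ← sub_eq_zero, ← map_sub]
    exact (gramDiag_eq_zero_iff halt (altSub_le_lieSub halt hc)).2 hc
  have hgy : gramDiag f b y = fun k => d k.swap := by
    rw [← gramDiag_sum_rankOneOp hb d, ← hy', ← sub_eq_zero, ← map_sub]
    exact (gramDiag_eq_zero_iff halt (altSub_le_lieSub halt hd)).2 hd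
  have h1 : halfTrace f b ⁅x, y⁆ = halfTrace f b ⁅x', y'⁆ := by
    have h2 : ⁅x, y⁆ = ⁅x', y'⁆ + (⁅x, y - y'⁆ - ⁅y', x - x'⁆) := by
      rw [lie_sub, lie_sub, ← lie_skew y' x, ← lie_skew y' x']
      abel
    rw [h2, map_add, map_sub, hzero hx hd, hzero _ hc, sub_zero, add_zero]
    exact sum_mem fun k _ => (lieOf f).smul_mem _ (rankOneOp_self_mem_lieOf halt _)
  have hterm (k l : Fin n ⊕ Fin n) :
      halfTrace f b ⁅rankOneOp f (b k) (b k), rankOneOp f (b l) (b l)⁆ =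
        if l = k.swap then 1 else 0 := by
    rw [lie_rankOneOp (rankOneOp_self_mem_lieOf halt _), rankOneOp_apply, map_smul, map_smul,
      LinearMap.smul_apply, ← smul_add, ← sub_eq_add_of_charTwo F, ← wedgeOp_eq, map_smul,
      halfTrace_wedgeOp hb halt, hb.apply]
    split_ifs <;> simp
  rw [h1, hx', hy', hgx, hgy, sum_lie, map_sum]
  refine (Fintype.sum_equiv (Equiv.sumComm (Fin n) (Fin n)) _ _ fun k => ?_)
  rw [lie_sum, map_sum, Finset.sum_eq_single k.swap]
  · rw [smul_lie, lie_smul, map_smul, map_smul, hterm, if_pos rfl]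
    simp
  · intro l _ hl
    rw [smul_lie, lie_smul, map_smul, map_smul, hterm, if_neg hl]
    simp
  · simp

/-- The diagonals of the off-diagonal blocks and the trace of the upper left block define a
homomorphism of `L(f)` onto the Heisenberg algebra. -/
noncomputable def toHeisenberg (hf : f.Nondegenerate) (hb : IsSymplecticBasis f b)
    (halt : f.IsAlt) : lieOf f →ₗ⁅F⁆ HeisenbergAlgebra F n where
  toFun x := ((fun i => gramDiag f b x (Sum.inr i), fun i => gramDiag f b x (Sum.inl i),
    halfTrace f b x) : (Fin n → F) × (Fin n → F) × F)
  map_add' x y := by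
    refine Prod.ext ?_ (Prod.ext ?_ ?_)
    · exact funext fun i => congrFun (map_add (gramDiag f b) (x : End F V) y) _
    · exact funext fun i => congrFun (map_add (gramDiag f b) (x : End F V) y) _
    · exact map_add (halfTrace f b) (x : End F V) y
  map_smul' c x := by
    refine Prod.ext ?_ (Prod.ext ?_ ?_)
    · exact funext fun i => congrFun (map_smul (gramDiag f b) c (x : End F V)) _
    · exact funext fun i => congrFun (map_smul (gramDiag f b) c (x : End F V)) _
    · exact map_smul (halfTrace f b) c (x : End F V)
  map_lie' := by
    intro x y
    have h0 : gramDiag f b ⁅(x : End F V), (y : End F V)⁆ = 0 :=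
      (gramDiag_eq_zero_iff halt ((lieOf f).lie_mem x.2 y.2)).2 (lie_mem_altSub halt x.2 y.2)
    refine Prod.ext ?_ (Prod.ext ?_ ?_)
    · exact funext fun i => congrFun h0 _
    · exact funext fun i => congrFun h0 _
    · change halfTrace f b ⁅(x : End F V), (y : End F V)⁆ = ∑ i,
        (gramDiag f b x (Sum.inr i) * gramDiag f b y (Sum.inl i) -
          gramDiag f b y (Sum.inr i) * gramDiag f b x (Sum.inl i))
      rw [halfTrace_lie hf hb halt x.2 y.2, Fintype.sum_sum_type, Finset.sum_sub_distrib,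
        CharTwo.sub_eq_add, add_comm]
      refine congrArg _ (Finset.sum_congr rfl fun i _ => ?_)
      rw [mul_comm]
      rfl

theorem toHeisenberg_eq_zero_iff (hf : f.Nondegenerate) (hb : IsSymplecticBasis f b)
    (halt : f.IsAlt) (hn : 0 < n) (x : lieOf f) :
    toHeisenberg hf hb halt x = 0 ↔ x ∈ derivedIdeal f 2 := by
  rw [← coe_mem_derivedSub, derivedSub_two hf hb halt hn, mem_perpSub,
    mem_perpSpan_iff hf hb halt hn, ← gramDiag_eq_zero_iff (b := b) halt x.2]
  constructor
  · intro h
    refine ⟨funext ?_, congrArg (fun t : (Fin n → F) × (Fin n → F) × F => t.2.2) h⟩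
    rintro (i | i)
    · exact congrFun (congrArg (fun t : (Fin n → F) × (Fin n → F) × F => t.2.1) h) i
    · exact congrFun (congrArg (fun t : (Fin n → F) × (Fin n → F) × F => t.1) h) i
  · rintro ⟨h, h'⟩
    exact Prod.ext (funext fun i => congrFun h _) (Prod.ext (funext fun i => congrFun h _) h')

theorem toHeisenberg_surjective (hf : f.Nondegenerate) (hb : IsSymplecticBasis f b)
    (halt : f.IsAlt) (hn : 0 < n) : Function.Surjective (toHeisenberg hf hb halt) := by
  rintro ⟨p, q, r⟩
  let y : End F V := ∑ k, Sum.elim p q k • rankOneOp f (b k) (b k)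
  let w : End F V := wedgeOp f ((r - halfTrace f b y) • b (Sum.inl ⟨0, hn⟩)) (b (Sum.inr ⟨0, hn⟩))
  have hy : y ∈ lieOf f :=
    sum_mem fun k _ => (lieOf f).smul_mem _ (rankOneOp_self_mem_lieOf halt _)
  have hw : w ∈ altSub halt := wedgeOp_mem_altSub halt _ _
  have hdiag : gramDiag f b (y + w) = fun i => Sum.elim p q i.swap := by
    rw [map_add, gramDiag_sum_rankOneOp hb,
      (gramDiag_eq_zero_iff halt (altSub_le_lieSub halt hw)).2 hw, add_zero]
  have htr : halfTrace f b (y + w) = r := by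
    rw [map_add, halfTrace_wedgeOp hb halt, map_smul, LinearMap.smul_apply, hb.apply]
    simp
  refine ⟨⟨y + w, add_mem hy (altSub_le_lieSub halt hw)⟩, Prod.ext ?_ (Prod.ext ?_ htr)⟩
  · exact funext fun i => congrFun hdiag _
  · exact funext fun i => congrFun hdiag _

end Heisenberg

/-! ### Composition series of `gl(V)` -/

section Series

variable {F V : Type*} [Field F] [AddCommGroup V] [Module F V] [CharP F 2] [FiniteDimensional F V]
  {f : LinearMap.BilinForm F V} {n : ℕ} {b : Basis (Fin n ⊕ Fin n) F V}

omit [CharP F 2] [FiniteDimensional F V] in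
theorem isTrivial_bot_scalarSub :
    LieModule.IsTrivial (lieOf f) (lieFactor ⊥ (scalarSub f)) :=
  lieFactor_isTrivial_iff.2 fun y x hx => by
    rw [lie_scalarSub y hx]
    exact zero_mem _

theorem isTrivial_derivedSub (hf : f.Nondegenerate) (hb : IsSymplecticBasis f b)
    (halt : f.IsAlt) (hn : 0 < n) :
    LieModule.IsTrivial (lieOf f) (lieFactor (derivedSub f 2) (derivedSub f 1)) := by
  rw [derivedSub_one hf hb halt, derivedSub_two hf hb halt hn, lieFactor_isTrivial_iff]
  exact fun y x hx => lie_mem_perpSpan hf y.2 (mem_span_wedgeOp hb halt hx)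

theorem isTrivial_lieSub_comap_altPart (hf : f.Nondegenerate) :
    LieModule.IsTrivial (lieOf f)
      (lieFactor (lieSub f) (LieSubmodule.comap (altPart hf) (scalarSub f))) :=
  lieFactor_isTrivial_iff.2 fun y x hx => by
    refine altPart_eq_zero_iff (hf := hf).1 ?_
    rw [LieModuleHom.map_lie]
    exact lie_scalarSub y hx

omit [CharP F 2] [FiniteDimensional F V] in
theorem isTrivial_slSub_top : LieModule.IsTrivial (lieOf f) (lieFactor (slSub f) ⊤) :=
  lieFactor_isTrivial_iff.2 fun y x _ => by
    change LinearMap.trace F V ⁅(y : End F V), x⁆ = 0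
    rw [LieRing.of_associative_ring_bracket, map_sub, LinearMap.trace_mul_comm, sub_self]

theorem exists_isLieCompositionSeries_of_even (hf : f.Nondegenerate) (hb : IsSymplecticBasis f b)
    (halt : f.IsAlt) (hn : 2 ≤ n) (h2 : Even n) {W : ℕ → Submodule F (End F V)}
    (hW : IsSubspaceChain (derivedSub f 1).toSubmodule (lieSub f).toSubmodule (2 * n) W) :
    ∃ N : ℕ → LieSubmodule F (lieOf f) (End F V),
      N 0 = ⊥ ∧ N 1 = scalarSub f ∧ N 2 = derivedSub f 2 ∧
      (∀ j ≤ 2 * n, (N (3 + j)).toSubmodule = W j) ∧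
      N (2 * n + 4) = LieSubmodule.comap (altPart hf) (scalarSub f) ∧
      N (2 * n + 5) = slSub f ∧ N (2 * n + 6) = ⊤ ∧
      IsLieCompositionSeries (2 * n + 6) N ∧
      ∀ i < 2 * n + 6, i ≠ 1 → i ≠ 2 * n + 4 →
        LieModule.IsTrivial (lieOf f) (lieFactor (N i) (N (i + 1))) := by
  have : Nontrivial V := nontrivial_of_finrank_pos (R := F) (by have := hb.finrank_eq; omega)
  obtain ⟨X, hXW, hX0, hXn, hX⟩ := exists_lieSubmodule_chain hf hb halt hW
  let N : ℕ → LieSubmodule F (lieOf f) (End F V)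
    | 0 => ⊥
    | 1 => scalarSub f
    | 2 => derivedSub f 2
    | j + 3 => if j ≤ 2 * n then X j else
        if j = 2 * n + 1 then LieSubmodule.comap (altPart hf) (scalarSub f) else
        if j = 2 * n + 2 then slSub f else ⊤
  have hNX (j : ℕ) (hj : j ≤ 2 * n) : N (j + 3) = X j := if_pos hj
  have hNU : N (2 * n + 1 + 3) = LieSubmodule.comap (altPart hf) (scalarSub f) := by
    change ite _ _ _ = _
    rw [if_neg (by omega), if_pos rfl]
  have hNs : N (2 * n + 2 + 3) = slSub f := by
    change ite _ _ _ = _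
    rw [if_neg (by omega), if_neg (by omega), if_pos rfl]
  have hNt : N (2 * n + 3 + 3) = ⊤ := by
    change ite _ _ _ = _
    rw [if_neg (by omega), if_neg (by omega), if_neg (by omega)]
  have hstep : ∀ i < 2 * n + 6, N i ⋖ N (i + 1) ∧ (i ≠ 1 → i ≠ 2 * n + 4 →
      LieModule.IsTrivial (lieOf f) (lieFactor (N i) (N (i + 1)))) := by
    intro i hi
    rcases i with _ | _ | _ | j
    · exact ⟨bot_covBy_scalarSub, fun _ _ => isTrivial_bot_scalarSub⟩
    · refine ⟨?_, fun h => absurd rfl h⟩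
      change scalarSub f ⋖ derivedSub f 2
      have h := scalarSub_inf_perpSub_covBy hf hb halt hn
      rw [derivedSub_two hf hb halt (by omega)]
      rwa [inf_eq_left.2 (scalarSub_le_perpSub hf hb halt (by omega) h2)] at h
    · have h3 : N 3 = derivedSub f 1 := (hNX 0 (Nat.zero_le _)).trans hX0
      change derivedSub f 2 ⋖ N 3 ∧
        (_ → _ → LieModule.IsTrivial (lieOf f) (lieFactor (derivedSub f 2) (N 3)))
      rw [h3]
      exact ⟨derivedSub_two_covBy_derivedSub_one hf hb halt (by omega),
        fun _ _ => isTrivial_derivedSub hf hb halt (by omega)⟩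
    · change N (j + 3) ⋖ N (j + 1 + 3) ∧ (_ → _ →
        LieModule.IsTrivial (lieOf f) (lieFactor (N (j + 3)) (N (j + 1 + 3))))
      obtain hj | rfl | rfl | rfl : j < 2 * n ∨ j = 2 * n ∨ j = 2 * n + 1 ∨ j = 2 * n + 2 := by
        omega
      · rw [hNX j hj.le, hNX (j + 1) hj]
        exact ⟨(hX j hj).1, fun _ _ => (hX j hj).2⟩
      · rw [hNX _ le_rfl, hNU, hXn]
        exact ⟨lieSub_covBy_comap_altPart hf hb, fun _ _ => isTrivial_lieSub_comap_altPart hf⟩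
      · refine ⟨?_, fun _ h => absurd rfl h⟩
        rw [hNU, hNs]
        have h := comap_altPart_inf_slSub_covBy hf hb halt hn
        rwa [inf_eq_left.2 (comap_altPart_scalarSub_le_slSub hf hb halt (by omega) h2)] at h
      · rw [hNs, hNt]
        exact ⟨slSub_covBy_top hf hb halt (by omega), fun _ _ => isTrivial_slSub_top⟩
  refine ⟨N, rfl, rfl, rfl, fun j hj => ?_, hNU, hNs, hNt,
    isLieCompositionSeries_iff.2 ⟨rfl, hNt, fun i hi => (hstep i hi).1⟩,
    fun i hi => (hstep i hi).2⟩
  rw [add_comm, hNX j hj, hXW j hj]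

theorem exists_isLieCompositionSeries_of_not_even (hf : f.Nondegenerate)
    (hb : IsSymplecticBasis f b) (halt : f.IsAlt) (hn : 2 ≤ n) (h2 : ¬ Even n)
    {W : ℕ → Submodule F (End F V)}
    (hW : IsSubspaceChain (derivedSub f 1).toSubmodule (lieSub f).toSubmodule (2 * n) W) :
    ∃ N : ℕ → LieSubmodule F (lieOf f) (End F V),
      N 0 = ⊥ ∧ N 1 = derivedSub f 2 ∧
      (∀ j ≤ 2 * n, (N (2 + j)).toSubmodule = W j) ∧
      N (2 * n + 3) = slSub f ∧ N (2 * n + 4) = ⊤ ∧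
      IsLieCompositionSeries (2 * n + 4) N ∧
      ∀ i < 2 * n + 4, i ≠ 0 → i ≠ 2 * n + 2 →
        LieModule.IsTrivial (lieOf f) (lieFactor (N i) (N (i + 1))) := by
  obtain ⟨X, hXW, hX0, hXn, hX⟩ := exists_lieSubmodule_chain hf hb halt hW
  let N : ℕ → LieSubmodule F (lieOf f) (End F V)
    | 0 => ⊥
    | 1 => derivedSub f 2
    | j + 2 => if j ≤ 2 * n then X j else if j = 2 * n + 1 then slSub f else ⊤
  have hNX (j : ℕ) (hj : j ≤ 2 * n) : N (j + 2) = X j := if_pos hj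
  have hNs : N (2 * n + 1 + 2) = slSub f := by
    change ite _ _ _ = _
    rw [if_neg (by omega), if_pos rfl]
  have hNt : N (2 * n + 2 + 2) = ⊤ := by
    change ite _ _ _ = _
    rw [if_neg (by omega), if_neg (by omega)]
  have hstep : ∀ i < 2 * n + 4, N i ⋖ N (i + 1) ∧ (i ≠ 0 → i ≠ 2 * n + 2 →
      LieModule.IsTrivial (lieOf f) (lieFactor (N i) (N (i + 1)))) := by
    intro i hi
    rcases i with _ | _ | j
    · refine ⟨?_, fun h => absurd rfl h⟩
      change ⊥ ⋖ derivedSub f 2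
      have h := scalarSub_inf_perpSub_covBy hf hb halt hn
      rw [derivedSub_two hf hb halt (by omega)]
      rwa [show scalarSub f ⊓ perpSub hf = ⊥ from le_bot_iff.1 fun x hx =>
        (LieSubmodule.mem_bot x).2
          (eq_zero_of_mem_scalarSub_of_mem_perpSub hf hb halt h2 hx.1 hx.2)] at h
    · have h3 : N 2 = derivedSub f 1 := (hNX 0 (Nat.zero_le _)).trans hX0
      change derivedSub f 2 ⋖ N 2 ∧
        (_ → _ → LieModule.IsTrivial (lieOf f) (lieFactor (derivedSub f 2) (N 2)))
      rw [h3]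
      exact ⟨derivedSub_two_covBy_derivedSub_one hf hb halt (by omega),
        fun _ _ => isTrivial_derivedSub hf hb halt (by omega)⟩
    · change N (j + 2) ⋖ N (j + 1 + 2) ∧ (_ → _ →
        LieModule.IsTrivial (lieOf f) (lieFactor (N (j + 2)) (N (j + 1 + 2))))
      obtain hj | rfl | rfl : j < 2 * n ∨ j = 2 * n ∨ j = 2 * n + 1 := by
        omega
      · rw [hNX j hj.le, hNX (j + 1) hj]
        exact ⟨(hX j hj).1, fun _ _ => (hX j hj).2⟩
      · refine ⟨?_, fun _ h => absurd rfl h⟩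
        rw [hNX _ le_rfl, hNs, hXn]
        have h := comap_altPart_inf_slSub_covBy hf hb halt hn
        rwa [comap_altPart_inf_slSub_eq_lieSub hf hb halt (by omega) h2] at h
      · rw [hNs, hNt]
        exact ⟨slSub_covBy_top hf hb halt (by omega), fun _ _ => isTrivial_slSub_top⟩
  refine ⟨N, rfl, rfl, fun j hj => ?_, hNs, hNt,
    isLieCompositionSeries_iff.2 ⟨rfl, hNt, fun i hi => (hstep i hi).1⟩,
    fun i hi => (hstep i hi).2⟩
  rw [add_comm, hNX j hj, hXW j hj]

theorem exists_isSubspaceChain_derivedSub (hf : f.Nondegenerate) (hb : IsSymplecticBasis f b)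
    (halt : f.IsAlt) : ∃ W : ℕ → Submodule F (End F V),
      IsSubspaceChain (derivedSub f 1).toSubmodule (lieSub f).toSubmodule (2 * n) W := by
  refine exists_isSubspaceChain _ _ _ (derivedSub_le_lieSub 1) ?_
  rw [finrank_lieSub hb halt, derivedSub_one hf hb halt]

/-! ### The non-trivial factors -/

theorem range_altPart_comp_incl (hf : f.Nondegenerate) (hb : IsSymplecticBasis f b)
    (halt : f.IsAlt) (hn : 0 < n) :
    ((altPart hf).comp (slSub f).incl).range = derivedSub f 2 := by
  ext y
  rw [LieModuleHom.mem_range, derivedSub_two hf hb halt hn, mem_perpSub,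
    mem_perpSpan_iff hf hb halt hn]
  constructor
  · rintro ⟨x, rfl⟩
    exact ⟨altPart_mem_altSub hf halt x, (halfTrace_altPart hf hb halt x).trans x.2⟩
  · rintro ⟨hy, h0⟩
    rw [← range_altPart hf hb halt] at hy
    obtain ⟨x, rfl⟩ := (LieModuleHom.mem_range _ _).1 hy
    rw [halfTrace_altPart hf hb halt] at h0
    exact ⟨⟨x, h0⟩, rfl⟩

theorem nonempty_equiv_of_even (hf : f.Nondegenerate) (hb : IsSymplecticBasis f b)
    (halt : f.IsAlt) (hn : 0 < n) :
    Nonempty (lieFactor (scalarSub f) (derivedSub f 2) ≃ₗ⁅F, lieOf f⁆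
      lieFactor (LieSubmodule.comap (altPart hf) (scalarSub f)) (slSub f)) := by
  let q := LieSubmodule.Quotient.mk' (scalarSub f)
  refine nonempty_quot_lieModuleEquiv_quot_of_range_eq _ _ (q.comp (derivedSub f 2).incl)
    (q.comp ((altPart hf).comp (slSub f).incl)) (fun x => ?_) (fun x => ?_) ?_
  · exact LieSubmodule.Quotient.mk_eq_zero _
  · exact LieSubmodule.Quotient.mk_eq_zero _
  · have h := range_altPart_comp_incl hf hb halt hn
    ext t
    rw [LieModuleHom.mem_range, LieModuleHom.mem_range]
    constructor
    · rintro ⟨y, rfl⟩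
      obtain ⟨x, hx⟩ := (LieModuleHom.mem_range _ _).1 (h.ge y.2)
      exact ⟨x, congrArg q hx⟩
    · rintro ⟨x, rfl⟩
      exact ⟨⟨_, h.le ((LieModuleHom.mem_range _ _).2 ⟨x, rfl⟩)⟩, rfl⟩

theorem nonempty_equiv_lieFactor_lieSub_slSub (hf : f.Nondegenerate) (hb : IsSymplecticBasis f b)
    (halt : f.IsAlt) (hn : 0 < n) :
    Nonempty (↥(derivedIdeal f 2) ≃ₗ⁅F, lieOf f⁆ lieFactor (lieSub f) (slSub f)) := by
  refine nonempty_lieModuleEquiv_quot_of_range_eq _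
    ((lieOf f).incl'.comp (LieSubmodule.incl (derivedIdeal f 2)))
    ((altPart hf).comp (slSub f).incl) (Subtype.val_injective.comp Subtype.val_injective)
    (fun x => altPart_eq_zero_iff) ?_
  rw [range_altPart_comp_incl hf hb halt hn]
  ext x
  rw [LieModuleHom.mem_range, mem_derivedSub]
  exact ⟨fun ⟨y, h⟩ => ⟨y, y.2, h⟩, fun ⟨y, hy, h⟩ => ⟨⟨y, hy⟩, h⟩⟩

theorem not_isTrivial_lieFactor_scalarSub (hf : f.Nondegenerate) (hb : IsSymplecticBasis f b)
    (halt : f.IsAlt) (hn : 2 ≤ n) :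
    ¬ LieModule.IsTrivial (lieOf f) (lieFactor (scalarSub f) (derivedSub f 2)) := by
  rw [lieFactor_isTrivial_iff, derivedSub_two hf hb halt (by omega)]
  intro h
  obtain ⟨y, x, hx, hyx⟩ := exists_lie_notMem_scalarSub hf hb halt hn
  exact hyx (h y x hx)

theorem not_isTrivial_derivedIdeal_two (hf : f.Nondegenerate) (hb : IsSymplecticBasis f b)
    (halt : f.IsAlt) (hn : 2 ≤ n) :
    ¬ LieModule.IsTrivial (lieOf f) ↥(derivedIdeal f 2) := by
  intro h
  obtain ⟨y, x, hx, hyx⟩ := exists_lie_notMem_scalarSub hf hb halt hn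
  obtain ⟨x, rfl⟩ := exists_coe_eq_of_mem_perpSub hf hb halt (by omega) hx
  have h0 : ⁅y, ((x : lieOf f) : End F V)⁆ = 0 :=
    congrArg (fun t : ↥(derivedIdeal f 2) => ((t : lieOf f) : End F V)) (h.trivial y x)
  rw [h0] at hyx
  exact hyx (zero_mem _)

theorem finrank_derivedIdeal_two (hf : f.Nondegenerate) (hb : IsSymplecticBasis f b)
    (halt : f.IsAlt) (hn : 0 < n) :
    finrank F ↥(derivedIdeal f 2) + 1 = (2 * n).choose 2 := by
  rw [← finrank_perpSub hf hb halt hn, ← derivedSub_two hf hb halt hn]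
  congr 1
  exact (Submodule.equivMapOfInjective (lieOf f).toSubmodule.subtype Subtype.val_injective
    (derivedIdeal f 2).toSubmodule).finrank_eq

theorem finrank_lieFactor_scalarSub (hf : f.Nondegenerate) (hb : IsSymplecticBasis f b)
    (halt : f.IsAlt) (hn : 0 < n) (h2 : Even n) :
    finrank F (lieFactor (scalarSub f) (derivedSub f 2)) + 2 = (2 * n).choose 2 := by
  have : Nontrivial V := nontrivial_of_finrank_pos (R := F) (by have := hb.finrank_eq; omega)
  rw [← finrank_perpSub hf hb halt hn, ← derivedSub_two hf hb halt hn]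
  have h := finrank_lieFactor (P := scalarSub f) (Q := derivedSub f 2) (by
    rw [derivedSub_two hf hb halt hn]
    exact scalarSub_le_perpSub hf hb halt hn h2)
  have h1 : finrank F ↥(scalarSub f) = 1 := finrank_scalarSub
  rw [h1] at h
  change _ = finrank F ↥(derivedSub f 2) + 1
  omega

end Series

/-! ### Conclusion -/

theorem theorem1p1 {F V : Type*} [Field F] [CharP F 2] [AddCommGroup V] [Module F V]
    [FiniteDimensional F V] (m n : ℕ) (hm : m = 2 * n) (hm2 : 2 ≤ m)
    (hdim : Module.finrank F V = m)
    (f : LinearMap.BilinForm F V) (hf : f.Nondegenerate) (halt : f.IsAlt) :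
    -- a symplectic basis exists
    (∃ b : Module.Basis (Fin n ⊕ Fin n) F V, IsSymplecticBasis f b) ∧
    -- composition series of `gl(V)` if `4 ∣ m`
    (4 ∣ m →
      HasLieCompositionLength F (lieOf f) (Module.End F V) (m + 6) ∧
      (∃ W : ℕ → Submodule F (Module.End F V),
        IsSubspaceChain (derivedSub f 1).toSubmodule (lieSub f).toSubmodule m W) ∧
      (∀ b : Module.Basis (Fin n ⊕ Fin n) F V, IsSymplecticBasis f b →
        halfIdentity b ∈ slSub f ∧
        (∀ y ∈ lieOf f, ⁅halfIdentity b, y⁆ ∈ lieOf f) ∧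
        halfIdentity b ∉ lieOf f ∧
        ∃ U : LieSubmodule F (lieOf f) (Module.End F V),
          U.toSubmodule = (lieSub f).toSubmodule ⊔ Submodule.span F {halfIdentity b} ∧
          (∀ W : ℕ → Submodule F (Module.End F V),
            IsSubspaceChain (derivedSub f 1).toSubmodule (lieSub f).toSubmodule m W →
            ∃ N : ℕ → LieSubmodule F (lieOf f) (Module.End F V),
              N 0 = ⊥ ∧ N 1 = scalarSub f ∧ N 2 = derivedSub f 2 ∧
              (∀ j ≤ m, (N (3 + j)).toSubmodule = W j) ∧
              N (m + 4) = U ∧ N (m + 5) = slSub f ∧ N (m + 6) = ⊤ ∧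
              IsLieCompositionSeries (m + 6) N ∧
              ∀ i < m + 6, i ≠ 1 → i ≠ m + 4 →
                LieModule.IsTrivial (lieOf f) (lieFactor (N i) (N (i + 1)))) ∧
          Nonempty (lieFactor (scalarSub f) (derivedSub f 2) ≃ₗ⁅F, lieOf f⁆
            lieFactor U (slSub f))) ∧
      ¬ LieModule.IsTrivial (lieOf f) (lieFactor (scalarSub f) (derivedSub f 2)) ∧
      Module.finrank F (lieFactor (scalarSub f) (derivedSub f 2)) + 2 = m.choose 2 ∧
      (LieAlgebra.IsSimple F (↥(derivedIdeal f 2) ⧸ scalarIdeal f) ↔ 4 < m)) ∧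
    -- composition series of `gl(V)` if `4 ∤ m` and `m ≠ 2`
    (m ≠ 2 → ¬ 4 ∣ m →
      HasLieCompositionLength F (lieOf f) (Module.End F V) (m + 4) ∧
      (∃ W : ℕ → Submodule F (Module.End F V),
        IsSubspaceChain (derivedSub f 1).toSubmodule (lieSub f).toSubmodule m W) ∧
      (∀ W : ℕ → Submodule F (Module.End F V),
        IsSubspaceChain (derivedSub f 1).toSubmodule (lieSub f).toSubmodule m W →
        ∃ N : ℕ → LieSubmodule F (lieOf f) (Module.End F V),
          N 0 = ⊥ ∧ N 1 = derivedSub f 2 ∧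
          (∀ j ≤ m, (N (2 + j)).toSubmodule = W j) ∧
          N (m + 3) = slSub f ∧ N (m + 4) = ⊤ ∧
          IsLieCompositionSeries (m + 4) N ∧
          ∀ i < m + 4, i ≠ 0 → i ≠ m + 2 →
            LieModule.IsTrivial (lieOf f) (lieFactor (N i) (N (i + 1)))) ∧
      Nonempty (↥(derivedIdeal f 2) ≃ₗ⁅F, lieOf f⁆ lieFactor (lieSub f) (slSub f)) ∧
      ¬ LieModule.IsTrivial (lieOf f) ↥(derivedIdeal f 2) ∧
      LieAlgebra.IsSimple F ↥(derivedIdeal f 2) ∧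
      Module.finrank F ↥(derivedIdeal f 2) + 1 = m.choose 2) ∧
    -- identification of `L(f)`
    (Nonempty (↥(lieOf f) ≃ₗ⁅F, lieOf f⁆ ↥(symSquare F (lieOf f) V)) ∧
      ∀ b : Module.Basis (Fin n ⊕ Fin n) F V, IsSymplecticBasis f b →
        ∀ x : Module.End F V, x ∈ lieOf f ↔
          ∃ A B C : Matrix (Fin n) (Fin n) F, B.IsSymm ∧ C.IsSymm ∧
            LinearMap.toMatrix b b x = Matrix.fromBlocks A B C A.transpose) ∧
    -- identification of `L(f)^(1)`
    (Nonempty (↥(derivedIdeal f 1) ≃ₗ⁅F, lieOf f⁆ ↥(extSquare F (lieOf f) V)) ∧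
      ∀ b : Module.Basis (Fin n ⊕ Fin n) F V, IsSymplecticBasis f b →
        ∀ x : Module.End F V, x ∈ derivedSub f 1 ↔
          ∃ A B C : Matrix (Fin n) (Fin n) F, IsAlternatingMatrix B ∧ IsAlternatingMatrix C ∧
            LinearMap.toMatrix b b x = Matrix.fromBlocks A B C A.transpose) ∧
    -- identification of `L(f)^(2)`
    ((∃ Δ : ↥(extSquare F (lieOf f) V) →ₗ⁅F, lieOf f⁆ TrivialLieModule F (lieOf f) F,
        (∀ v w : V, TrivialLieModule.equiv F (lieOf f) F (Δ (wedge F (lieOf f) v w)) = f v w) ∧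
        Function.Surjective Δ ∧
        Nonempty (↥(derivedIdeal f 2) ≃ₗ⁅F, lieOf f⁆ ↥Δ.ker)) ∧
      ∀ b : Module.Basis (Fin n ⊕ Fin n) F V, IsSymplecticBasis f b →
        ∀ x : Module.End F V, x ∈ derivedSub f 2 ↔
          ∃ A B C : Matrix (Fin n) (Fin n) F, IsAlternatingMatrix B ∧ IsAlternatingMatrix C ∧
            A.trace = 0 ∧
            LinearMap.toMatrix b b x = Matrix.fromBlocks A B C A.transpose) ∧
    -- identification of `L(f) / L(f)^(2)`
    Nonempty ((↥(lieOf f) ⧸ derivedIdeal f 2) ≃ₗ⁅F⁆ HeisenbergAlgebra F n) := by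
  subst hm
  have hn : 0 < n := by omega
  obtain ⟨b₀, hb₀⟩ := exists_isSymplecticBasis hf halt hdim
  refine ⟨⟨b₀, hb₀⟩, fun h4 => ?_, fun hm h4 => ?_,
    ⟨nonempty_lieOf_equiv_symSquare hb₀ halt,
      fun b hb x => mem_lieOf_iff_exists_fromBlocks hb halt x⟩,
    ⟨nonempty_derivedIdeal_one_equiv_extSquare hf hb₀ halt, fun b hb x => ?_⟩,
    ⟨⟨extSquareForm hf hb₀ halt, equiv_extSquareForm_wedge hf hb₀ halt,
      extSquareForm_surjective hf hb₀ halt hn,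
      nonempty_derivedIdeal_two_equiv_ker hf hb₀ halt hn⟩, fun b hb x => ?_⟩,
    ⟨LieHom.quotEquivOfSurjective _ (toHeisenberg hf hb₀ halt)
      (toHeisenberg_eq_zero_iff hf hb₀ halt hn) (toHeisenberg_surjective hf hb₀ halt hn)⟩⟩
  · have h2 : Even n := even_iff_two_dvd.2 (by omega)
    have hn2 : 2 ≤ n := by omega
    have : Nontrivial V := nontrivial_of_finrank_pos (R := F) (by omega)
    obtain ⟨W₀, hW₀⟩ := exists_isSubspaceChain_derivedSub hf hb₀ halt
    refine ⟨?_, ⟨W₀, hW₀⟩, fun b hb => ⟨?_, fun y hy => ?_, halfIdentity_notMem_lieOf hf hb,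
      LieSubmodule.comap (altPart hf) (scalarSub f),
      comap_altPart_scalarSub_toSubmodule hf hb,
      fun W hW => exists_isLieCompositionSeries_of_even hf hb halt hn2 h2 hW,
      nonempty_equiv_of_even hf hb halt hn⟩,
      not_isTrivial_lieFactor_scalarSub hf hb₀ halt hn2,
      finrank_lieFactor_scalarSub hf hb₀ halt hn h2, fun h => ?_, fun h => ?_⟩
    · obtain ⟨N, -, -, -, -, -, -, -, hN, -⟩ :=
        exists_isLieCompositionSeries_of_even hf hb₀ halt hn2 h2 hW₀
      exact hN.hasLieCompositionLength
    · refine comap_altPart_scalarSub_le_slSub hf hb halt hn h2 ?_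
      change altPart hf (halfIdentity b) ∈ scalarSub f
      rw [altPart_halfIdentity hf hb]
      exact mem_scalarSub.2 ⟨1, (one_smul F 1).symm⟩
    · have h0 : altPart hf ⁅y, halfIdentity b⁆ = ⁅y, altPart hf (halfIdentity b)⁆ :=
        (altPart hf).map_lie ⟨y, hy⟩ (halfIdentity b)
      rw [altPart_halfIdentity hf hb, LieRing.of_associative_ring_bracket y 1, mul_one, one_mul,
        sub_self] at h0
      rw [← lie_skew]
      exact neg_mem (altPart_eq_zero_iff.1 h0)
    · by_contra hlt
      obtain rfl : n = 2 := by omega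
      exact not_isSimple_quotient_scalarIdeal hf hb₀ halt h
    · exact isSimple_quotient_scalarIdeal hf hb₀ halt (by omega)
  · have h2 : ¬ Even n := fun h => h4 (by have := h.two_dvd; omega)
    have hn3 : 3 ≤ n := by
      by_contra hlt
      obtain rfl | rfl : n = 1 ∨ n = 2 := by omega
      · exact hm rfl
      · exact h4 (by norm_num)
    obtain ⟨W₀, hW₀⟩ := exists_isSubspaceChain_derivedSub hf hb₀ halt
    refine ⟨?_, ⟨W₀, hW₀⟩,
      fun W hW => exists_isLieCompositionSeries_of_not_even hf hb₀ halt (by omega) h2 hW,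
      nonempty_equiv_lieFactor_lieSub_slSub hf hb₀ halt hn,
      not_isTrivial_derivedIdeal_two hf hb₀ halt (by omega),
      isSimple_derivedIdeal_two hf hb₀ halt hn3 h2, finrank_derivedIdeal_two hf hb₀ halt hn⟩
    obtain ⟨N, -, -, -, -, -, hN, -⟩ :=
      exists_isLieCompositionSeries_of_not_even hf hb₀ halt (by omega) h2 hW₀
    exact hN.hasLieCompositionLength
  · rw [derivedSub_one hf hb halt]
    exact mem_altSub_iff_exists_fromBlocks hb halt x
  · rw [derivedSub_two hf hb halt hn]
    exact mem_perpSpan_iff_exists_fromBlocks hf hb halt hn x
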